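/- There is a universal constant $c_0>0$ such that the following holds for every integer $n\ge 1$, every $\rho_0\in(0,1)$, and every Gaussian vector $X=(X_1,\dots,X_n)$ (possibly degenerate) with $\mathbb{E}[X_i]=0$ and $\operatorname{var}(X_i)=1$ for all $i$, whose correlation matrix $R$ satisfies $R_{ij}\le\rho_0$ for all $i\ne j$. Let $M_n(X)=\max_{1\le i\le n}X_i$ and $\ell_2(n)=\log\log(\max\{n,3\})$, and let $\mu_n$ stand for either $\mathbb{E}[M_n(X)]$ or any median $\operatorname{med}[M_n(X)]$ of $M_n(X)$. Then $M_n(X)$ is integrable and $$\mu_n\ \ge\ \sqrt{2(1-\rho_0)\log(n)}\;-\;c_0\sqrt{\ell_2(n)}.$$ Furthermore, if $R_{ij}=\rho_0$ for all $i\ne j$, then $$\mu_n\ \le\ \sqrt{2(1-\rho_0)\log(n)}.$$ -/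

import Mathlib

open MeasureTheory ProbabilityTheory

/-- The maximum `max_{1 ≤ i ≤ n} x_i` of the coordinates of a vector with `n ≥ 1` coordinates. -/
noncomputable def maxCoord {n : ℕ} [NeZero n] (x : Fin n → ℝ) : ℝ :=
  Finset.univ.sup' Finset.univ_nonempty x

/-- The correlation matrix of a random vector `X = (X_1, …, X_n)`:
`R_ij = cov(X_i, X_j) / (sd(X_i) sd(X_j))`. -/
noncomputable def corrMatrix {Ω : Type*} [MeasurableSpace Ω] {n : ℕ}
    (X : Fin n → Ω → ℝ) (P : Measure Ω) : Matrix (Fin n) (Fin n) ℝ :=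
  Matrix.of fun i j => cov[X i, X j; P] / (√(Var[X i; P]) * √(Var[X j; P]))

/-- `m` is a median of the real random variable `Y`: `P(Y ≤ m) ≥ 1/2` and `P(Y ≥ m) ≥ 1/2`. -/
def IsMedian {Ω : Type*} [MeasurableSpace Ω] (Y : Ω → ℝ) (P : Measure Ω) (m : ℝ) : Prop :=
  1 / 2 ≤ P.real {ω | Y ω ≤ m} ∧ 1 / 2 ≤ P.real {ω | m ≤ Y ω}

/-- The iterated logarithm `ℓ₂(n) = log log (max {n, 3})`. -/
noncomputable def ell2 (n : ℕ) : ℝ :=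
  Real.log (Real.log (max (n : ℝ) 3))

/-! Write `t = √(2 log n)`. The lower bound rests on Slepian's inequality: among centered Gaussian
vectors with given variances, larger correlations make the maximum smaller. Hence `X` may be
compared with `√ρ₀ g + √(1 - ρ₀) zᵢ`, where `g, z₁, …, zₙ` are independent standard normal. Its
maximum is `√ρ₀ g + √(1 - ρ₀) max zᵢ`, and `max zᵢ` falls below `t - 2` only by an amount of bounded
mean. So the lower deviation `E (a - M)₊` is bounded at `a = √(1 - ρ₀) (t - 2)`
(`integral_posPart_sub_maxCoord_le_six`), which controls the mean directly and the medians through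
Markov's inequality. The loss is a constant, absorbed in `√ℓ₂(n)`, which is bounded away from zero.

Slepian's inequality is obtained by a Lindeberg replacement (`SlepianJet.integral_le`), which needs
no density and so covers degenerate vectors. It is tested on a smooth cutoff, at the harmless price
of a unit shift.

For the upper bound, equicorrelation makes the coordinate mean `A` independent of the residuals `Xᵢ
- A`, whose variances are at most `1 - ρ₀`. As `A` has mean zero, the usual exponential moment bound
on the residuals settles the expectation (`integral_maxCoord_le`). For medians
(`measureReal_le_maxCoord_lt_half`), conditioning on the residuals turns `P(M ≥ m)` into an
expectation of the normal distribution function `Φ`, and log-concavity of `Φ` reduces it to the same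
exponential moment. This requires `A` to fluctuate enough; otherwise `ρ₀` is so small that a union
bound suffices. -/

/-! ### Smooth test functions with signed derivatives. -/

lemma abs_mul_le {x y a b : ℝ} (hx : |x| ≤ a) (hy : |y| ≤ b) : |x * y| ≤ a * b := by
  rw [abs_mul]
  exact mul_le_mul hx hy (abs_nonneg _) ((abs_nonneg _).trans hx)

/-- A real function on `ℝ^ι` with second-order Taylor expansion `F + L + Q / 2`, where `L` is given
by the vector `G` and `Q` by the matrix `H`, with uniform bounds, and with the signs which make it
increase in Gaussian comparison: `F ≥ 0`, `G ≤ 0` and the off-diagonal entries of `H` nonnegative. -/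
structure SlepianJet {ι : Type*} [Fintype ι] (F : (ι → ℝ) → ℝ) (G : ι → (ι → ℝ) → ℝ)
    (H : ι → ι → (ι → ℝ) → ℝ) (C : ℝ) : Prop where
  one_le : 1 ≤ C
  measurable : Measurable F
  measurable_fst : ∀ i, Measurable (G i)
  measurable_snd : ∀ i j, Measurable (H i j)
  nonneg : ∀ v, 0 ≤ F v
  nonpos : ∀ i v, G i v ≤ 0
  offDiag_nonneg : ∀ i j, i ≠ j → ∀ v, 0 ≤ H i j v
  bound : ∀ v, |F v| ≤ C
  bound_fst : ∀ i v, |G i v| ≤ C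
  bound_snd : ∀ i j v, |H i j v| ≤ C
  bound_lin : ∀ v w : ι → ℝ, |∑ i, G i v * w i| ≤ C * ‖w‖
  taylor_zero : ∀ v w : ι → ℝ, |F (v + w) - F v| ≤ C * ‖w‖
  taylor_one : ∀ v w : ι → ℝ, |F (v + w) - F v - ∑ i, G i v * w i| ≤ C * ‖w‖ ^ 2
  taylor_two : ∀ v w : ι → ℝ, |F (v + w) - F v - ∑ i, G i v * w i
    - (1 / 2) * ∑ i, ∑ j, H i j v * (w i * w j)| ≤ C * ‖w‖ ^ 3

namespace SlepianJet

variable {ι : Type*} [Fintype ι] {F F' : (ι → ℝ) → ℝ} {G G' : ι → (ι → ℝ) → ℝ}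
  {H H' : ι → ι → (ι → ℝ) → ℝ} {C C' : ℝ}

lemma mono (h : SlepianJet F G H C) (hC : C ≤ C') : SlepianJet F G H C' where
  one_le := h.one_le.trans hC
  measurable := h.measurable
  measurable_fst := h.measurable_fst
  measurable_snd := h.measurable_snd
  nonneg := h.nonneg
  nonpos := h.nonpos
  offDiag_nonneg := h.offDiag_nonneg
  bound v := (h.bound v).trans hC
  bound_fst i v := (h.bound_fst i v).trans hC
  bound_snd i j v := (h.bound_snd i j v).trans hC
  bound_lin v w := (h.bound_lin v w).trans (by gcongr)
  taylor_zero v w := (h.taylor_zero v w).trans (by gcongr)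
  taylor_one v w := (h.taylor_one v w).trans (by gcongr)
  taylor_two v w := (h.taylor_two v w).trans (by gcongr)

/-- The Leibniz rule. The signs persist because the cross terms in the Hessian are products of two
nonpositive first derivatives. The factor 4 counts the terms of the second derivative, and also
those of the cubic remainder. -/
lemma mul (h : SlepianJet F G H C) (h' : SlepianJet F' G' H' C) :
    SlepianJet (fun v => F v * F' v) (fun i v => F v * G' i v + F' v * G i v)
      (fun i j v => F v * H' i j v + F' v * H i j v + G i v * G' j v + G j v * G' i v)
      (4 * C ^ 2) := by
  have hC := h.one_le
  have lin : ∀ v w : ι → ℝ, ∑ i, (F v * G' i v + F' v * G i v) * w i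
      = F v * ∑ i, G' i v * w i + F' v * ∑ i, G i v * w i := fun v w => by
    rw [Finset.mul_sum, Finset.mul_sum, ← Finset.sum_add_distrib]
    exact Finset.sum_congr rfl fun i _ => by ring
  have quad : ∀ v w : ι → ℝ, ∑ i, ∑ j, (F v * H' i j v + F' v * H i j v + G i v * G' j v
      + G j v * G' i v) * (w i * w j)
      = F v * (∑ i, ∑ j, H' i j v * (w i * w j)) + F' v * (∑ i, ∑ j, H i j v * (w i * w j))
        + 2 * ((∑ i, G i v * w i) * ∑ i, G' i v * w i) := fun v w => by
    have e : (∑ i, G i v * w i) * (∑ i, G' i v * w i)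
        = ∑ i, ∑ j, G j v * G' i v * (w i * w j) := by
      rw [Finset.sum_mul_sum, Finset.sum_comm]
      exact Finset.sum_congr rfl fun i _ => Finset.sum_congr rfl fun j _ => by ring
    have e' : (∑ i, G i v * w i) * (∑ i, G' i v * w i)
        = ∑ i, ∑ j, G i v * G' j v * (w i * w j) := by
      rw [Finset.sum_mul_sum]
      exact Finset.sum_congr rfl fun i _ => Finset.sum_congr rfl fun j _ => by ring
    rw [two_mul]
    nth_rewrite 1 [e]
    rw [e']
    simp only [Finset.mul_sum, ← Finset.sum_add_distrib]
    exact Finset.sum_congr rfl fun i _ => Finset.sum_congr rfl fun j _ => by ring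
  refine ⟨by nlinarith, h.measurable.mul h'.measurable,
    fun i => (h.measurable.mul (h'.measurable_fst i)).add (h'.measurable.mul (h.measurable_fst i)),
    fun i j => (((h.measurable.mul (h'.measurable_snd i j)).add
      (h'.measurable.mul (h.measurable_snd i j))).add
      ((h.measurable_fst i).mul (h'.measurable_fst j))).add
      ((h.measurable_fst j).mul (h'.measurable_fst i)),
    fun v => mul_nonneg (h.nonneg v) (h'.nonneg v), fun i v => ?_, fun i j hij v => ?_,
    fun v => ?_, fun i v => ?_, fun i j v => ?_, fun v w => ?_, fun v w => ?_, fun v w => ?_,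
    fun v w => ?_⟩
  · have := mul_nonneg (h.nonneg v) (neg_nonneg.2 (h'.nonpos i v))
    have := mul_nonneg (h'.nonneg v) (neg_nonneg.2 (h.nonpos i v))
    linarith
  · have := mul_nonneg (h.nonneg v) (h'.offDiag_nonneg i j hij v)
    have := mul_nonneg (h'.nonneg v) (h.offDiag_nonneg i j hij v)
    have := mul_nonneg_of_nonpos_of_nonpos (h.nonpos i v) (h'.nonpos j v)
    have := mul_nonneg_of_nonpos_of_nonpos (h.nonpos j v) (h'.nonpos i v)
    linarith
  · have := abs_mul_le (h.bound v) (h'.bound v)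
    nlinarith
  · have h1 := abs_le.1 (abs_mul_le (h.bound v) (h'.bound_fst i v))
    have h2 := abs_le.1 (abs_mul_le (h'.bound v) (h.bound_fst i v))
    exact abs_le.2 ⟨by nlinarith, by nlinarith⟩
  · have h1 := abs_le.1 (abs_mul_le (h.bound v) (h'.bound_snd i j v))
    have h2 := abs_le.1 (abs_mul_le (h'.bound v) (h.bound_snd i j v))
    have h3 := abs_le.1 (abs_mul_le (h.bound_fst i v) (h'.bound_fst j v))
    have h4 := abs_le.1 (abs_mul_le (h.bound_fst j v) (h'.bound_fst i v))
    exact abs_le.2 ⟨by nlinarith, by nlinarith⟩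
  · rw [lin]
    have h1 := abs_le.1 (abs_mul_le (h.bound v) (h'.bound_lin v w))
    have h2 := abs_le.1 (abs_mul_le (h'.bound v) (h.bound_lin v w))
    have : 0 ≤ C ^ 2 * ‖w‖ := by positivity
    exact abs_le.2 ⟨by nlinarith, by nlinarith⟩
  · have h1 := abs_le.1 (abs_mul_le (h.bound (v + w)) (h'.taylor_zero v w))
    have h2 := abs_le.1 (abs_mul_le (h'.bound v) (h.taylor_zero v w))
    have : 0 ≤ C ^ 2 * ‖w‖ := by positivity
    exact abs_le.2 ⟨by nlinarith, by nlinarith⟩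
  · rw [lin]
    have h1 := abs_le.1 (abs_mul_le (h.bound v) (h'.taylor_one v w))
    have h2 := abs_le.1 (abs_mul_le (h'.bound v) (h.taylor_one v w))
    have h3 := abs_le.1 (abs_mul_le (h.taylor_zero v w) (h'.taylor_zero v w))
    have : 0 ≤ C ^ 2 * ‖w‖ ^ 2 := by positivity
    generalize ∑ i, G i v * w i = l at *
    generalize ∑ i, G' i v * w i = l' at *
    exact abs_le.2 ⟨by nlinarith, by nlinarith⟩
  · rw [lin, quad]
    have h1 := abs_le.1 (abs_mul_le (h.bound v) (h'.taylor_two v w))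
    have h2 := abs_le.1 (abs_mul_le (h'.bound v) (h.taylor_two v w))
    have h3 := abs_le.1 (abs_mul_le (h.taylor_zero v w) (h'.taylor_one v w))
    have h4 := abs_le.1 (abs_mul_le (h.taylor_one v w) (h'.bound_lin v w))
    generalize ∑ i, G i v * w i = l at *
    generalize ∑ i, G' i v * w i = l' at *
    generalize ∑ i, ∑ j, H i j v * (w i * w j) = q at *
    generalize ∑ i, ∑ j, H' i j v * (w i * w j) = q' at *
    -- Each of the four products has total order three in `w`: 0 + 3, 0 + 3, 1 + 2 and 2 + 1.
    have e : F (v + w) * F' (v + w) - F v * F' v - (F v * l' + F' v * l)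
        - 1 / 2 * (F v * q' + F' v * q + 2 * (l * l'))
        = F v * (F' (v + w) - F' v - l' - 1 / 2 * q') + F' v * (F (v + w) - F v - l - 1 / 2 * q)
          + (F (v + w) - F v) * (F' (v + w) - F' v - l') + (F (v + w) - F v - l) * l' := by ring
    rw [e]
    exact abs_le.2 ⟨by linarith, by linarith⟩

lemma one : SlepianJet (ι := ι) (fun _ => 1) (fun _ _ => 0) (fun _ _ _ => 0) 1 := by
  refine ⟨le_rfl, measurable_const, fun _ => measurable_const, fun _ _ => measurable_const,
    ?_, ?_, ?_, ?_, ?_, ?_, ?_, ?_, ?_, ?_⟩ <;> intros <;> simp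

end SlepianJet

/-- The derivative of a Taylor remainder is the remainder of one order less for the derivative, so
each use of this mean value inequality gains one order. -/
lemma abs_le_mul_of_abs_deriv_le {g g' : ℝ → ℝ} {K r : ℝ} (hg : ∀ x, HasDerivAt g (g' x) x)
    (h0 : g 0 = 0) (hK : ∀ x, |x| ≤ |r| → |g' x| ≤ K) : |g r| ≤ K * |r| := by
  have := (convex_Icc (-|r|) |r|).norm_image_sub_le_of_norm_hasDerivWithin_le (f := g) (f' := g')
    (C := K) (x := 0) (y := r) (fun x _ => (hg x).hasDerivWithinAt)
    (fun x hx => hK x (abs_le.2 hx)) ⟨by simp, abs_nonneg r⟩ (abs_le.1 le_rfl)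
  simpa [h0] using this

lemma taylor_one_of_abs_deriv_le {f f' f'' : ℝ → ℝ} {C : ℝ} (h1 : ∀ x, HasDerivAt f (f' x) x)
    (h2 : ∀ x, HasDerivAt f' (f'' x) x) (hC : ∀ x, |f'' x| ≤ C) (v w : ℝ) :
    |f (v + w) - f v - f' v * w| ≤ C * |w| ^ 2 := by
  have hC0 : 0 ≤ C := (abs_nonneg _).trans (hC 0)
  have := abs_le_mul_of_abs_deriv_le (g := fun x => f (v + x) - f v - f' v * x)
    (g' := fun x => f' (v + x) - f' v) (K := C * |w|) (r := w)
    (fun x => by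
      refine ((((h1 (v + x)).comp_const_add v x).sub_const (f v)).sub
        ((hasDerivAt_id x).const_mul (f' v))).congr_deriv ?_
      simp)
    (by simp) fun x hx => by
      refine (abs_le_mul_of_abs_deriv_le (g := fun y => f' (v + y) - f' v)
        (g' := fun y => f'' (v + y)) (K := C) (r := x)
        (fun y => ((h2 (v + y)).comp_const_add v y).sub_const _) (by simp)
        fun y _ => hC _).trans (by gcongr)
  exact this.trans_eq (by ring)

lemma taylor_two_of_abs_deriv_le {f f' f'' f''' : ℝ → ℝ} {C : ℝ}
    (h1 : ∀ x, HasDerivAt f (f' x) x) (h2 : ∀ x, HasDerivAt f' (f'' x) x)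
    (h3 : ∀ x, HasDerivAt f'' (f''' x) x) (hC : ∀ x, |f''' x| ≤ C) (v w : ℝ) :
    |f (v + w) - f v - f' v * w - 1 / 2 * (f'' v * (w * w))| ≤ C * |w| ^ 3 := by
  have hC0 : 0 ≤ C := (abs_nonneg _).trans (hC 0)
  have := abs_le_mul_of_abs_deriv_le
    (g := fun x => f (v + x) - f v - f' v * x - 1 / 2 * (f'' v * (x * x)))
    (g' := fun x => f' (v + x) - f' v - f'' v * x) (K := C * |w| ^ 2) (r := w)
    (fun x => by
      have := ((((h1 (v + x)).comp_const_add v x).sub_const (f v)).sub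
        ((hasDerivAt_id x).const_mul (f' v))).sub
        ((((hasDerivAt_id x).mul (hasDerivAt_id x)).const_mul (f'' v)).const_mul (1 / 2))
      refine this.congr_deriv ?_
      simp only [id]
      ring)
    (by simp) fun x hx => (taylor_one_of_abs_deriv_le h2 h3 hC v x).trans (by gcongr)
  exact this.trans_eq (by ring)

/-- The Hessian of a function of one coordinate is diagonal, so no sign of `h''` is needed, only
that `h` is nonnegative and nonincreasing. -/
lemma SlepianJet.coord {ι : Type*} [Fintype ι] [DecidableEq ι] {h h' h'' h''' : ℝ → ℝ} {C : ℝ}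
    (hC : 1 ≤ C)
    (h1 : ∀ x, HasDerivAt h (h' x) x) (h2 : ∀ x, HasDerivAt h' (h'' x) x)
    (h3 : ∀ x, HasDerivAt h'' (h''' x) x) (b0 : ∀ x, |h x| ≤ C) (b1 : ∀ x, |h' x| ≤ C)
    (b2 : ∀ x, |h'' x| ≤ C) (b3 : ∀ x, |h''' x| ≤ C) (hn : ∀ x, 0 ≤ h x) (hn' : ∀ x, h' x ≤ 0)
    (k : ι) :
    SlepianJet (fun v : ι → ℝ => h (v k)) (fun i v => if i = k then h' (v k) else 0)
      (fun i j v => if i = k ∧ j = k then h'' (v k) else 0) C := by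
  have c0 : Continuous h := continuous_iff_continuousAt.2 fun x => (h1 x).continuousAt
  have c1 : Continuous h' := continuous_iff_continuousAt.2 fun x => (h2 x).continuousAt
  have c2 : Continuous h'' := continuous_iff_continuousAt.2 fun x => (h3 x).continuousAt
  have lin : ∀ v w : ι → ℝ, ∑ i, (if i = k then h' (v k) else 0) * w i = h' (v k) * w k := by
    intro v w; simp
  have quad : ∀ v w : ι → ℝ, ∑ i, ∑ j, (if i = k ∧ j = k then h'' (v k) else 0) * (w i * w j)
      = h'' (v k) * (w k * w k) := by
    intro v w; simp [ite_and]
  have hw : ∀ w : ι → ℝ, |w k| ≤ ‖w‖ := fun w => norm_le_pi_norm w k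
  refine ⟨hC, by fun_prop, fun i => ?_, fun i j => ?_, fun v => hn _, fun i v => ?_,
    fun i j hij v => ?_, fun v => b0 _, fun i v => ?_, fun i j v => ?_, fun v w => ?_,
    fun v w => ?_, fun v w => ?_, fun v w => ?_⟩
  · split_ifs <;> fun_prop
  · split_ifs <;> fun_prop
  · split_ifs; exacts [hn' _, le_rfl]
  · rw [if_neg]
    rintro ⟨rfl, rfl⟩
    exact hij rfl
  · split_ifs; exacts [b1 _, by simp; linarith]
  · split_ifs; exacts [b2 _, by simp; linarith]
  · rw [lin]
    exact abs_mul_le (b1 _) (hw w)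
  · refine (abs_le_mul_of_abs_deriv_le (g := fun y => h (v k + y) - h (v k))
        (g' := fun y => h' (v k + y)) (K := C) (r := w k)
        (fun y => ((h1 (v k + y)).comp_const_add (v k) y).sub_const _) (by simp)
        fun y _ => b1 _).trans ?_
    gcongr
    exact hw w
  · rw [lin]
    refine (taylor_one_of_abs_deriv_le h1 h2 b2 (v k) (w k)).trans ?_
    gcongr
    exact hw w
  · rw [lin, quad]
    refine (taylor_two_of_abs_deriv_le h1 h2 h3 b3 (v k) (w k)).trans ?_
    gcongr
    exact hw w

lemma SlepianJet.exists_prod {ι : Type*} [Fintype ι] [DecidableEq ι] {h h' h'' h''' : ℝ → ℝ}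
    {C : ℝ} (hC : 1 ≤ C)
    (h1 : ∀ x, HasDerivAt h (h' x) x) (h2 : ∀ x, HasDerivAt h' (h'' x) x)
    (h3 : ∀ x, HasDerivAt h'' (h''' x) x) (b0 : ∀ x, |h x| ≤ C) (b1 : ∀ x, |h' x| ≤ C)
    (b2 : ∀ x, |h'' x| ≤ C) (b3 : ∀ x, |h''' x| ≤ C) (hn : ∀ x, 0 ≤ h x) (hn' : ∀ x, h' x ≤ 0)
    (S : Finset ι) :
    ∃ G H C', SlepianJet (fun v : ι → ℝ => ∏ k ∈ S, h (v k)) G H C' := by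
  induction S using Finset.induction_on with
  | empty => exact ⟨_, _, _, by simpa using SlepianJet.one⟩
  | insert k S hk ih =>
    obtain ⟨G, H, C', hj⟩ := ih
    simp only [Finset.prod_insert hk]
    exact ⟨_, _, _, ((SlepianJet.coord hC h1 h2 h3 b0 b1 b2 b3 hn hn' k).mono
      (le_max_left C C')).mul (hj.mono (le_max_right C C'))⟩

lemma abs_bounded_of_eq_zero_off_Icc {f : ℝ → ℝ} (hf : Continuous f) {a b : ℝ}
    (h0 : ∀ x, x ∉ Set.Icc a b → f x = 0) : ∃ C, ∀ x, |f x| ≤ C := by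
  obtain ⟨C, hC⟩ := isCompact_Icc.exists_bound_of_continuousOn (s := Set.Icc a b) hf.continuousOn
  refine ⟨max C 0, fun x => ?_⟩
  by_cases hx : x ∈ Set.Icc a b
  · exact (hC x hx).trans (le_max_left _ _)
  · simp [h0 x hx]

/-- A jet for a smooth function lying between the indicators of `{x | ∀ i, x i ≤ s - 1}` and of
`{x | ∀ i, x i < s}`. -/
lemma exists_slepianJet_cutoff (ι : Type*) [Fintype ι] (s : ℝ) :
    ∃ F G H C, SlepianJet (ι := ι) F G H C ∧ (∀ v, F v ≤ 1) ∧
      (∀ v, (∀ i, v i ≤ s - 1) → F v = 1) ∧ (∀ v, (∃ i, s ≤ v i) → F v = 0) := by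
  classical
  set h : ℝ → ℝ := fun x => Real.smoothTransition (s - x) with hh
  have hs : ContDiff ℝ 3 h := by
    have : ContDiff ℝ 3 Real.smoothTransition := Real.smoothTransition.contDiff (n := 3)
    exact this.comp (contDiff_const.sub contDiff_id)
  have hs1 : ContDiff ℝ 2 (deriv h) := hs.deriv'
  have hs2 : ContDiff ℝ 1 (deriv (deriv h)) := hs1.deriv'
  have hs3 : ContDiff ℝ 0 (deriv (deriv (deriv h))) := hs2.deriv'
  -- All derivatives of `h` vanish off `[s - 1, s]`, hence are bounded by compactness; `z'` lets `z`
  -- be iterated.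
  have z : ∀ f : ℝ → ℝ, (∃ c c', (∀ x, x < s - 1 → f x = c) ∧ ∀ x, s < x → f x = c') →
      ∀ x, x ∉ Set.Icc (s - 1) s → deriv f x = 0 := by
    rintro f ⟨c, c', hc, hc'⟩ x hx
    rw [Set.mem_Icc, not_and_or, not_le, not_le] at hx
    rcases hx with hx | hx
    · have : f =ᶠ[nhds x] fun _ => c := by
        filter_upwards [Iio_mem_nhds hx] with y hy using hc y hy
      rw [this.deriv_eq]; simp
    · have : f =ᶠ[nhds x] fun _ => c' := by
        filter_upwards [Ioi_mem_nhds hx] with y hy using hc' y hy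
      rw [this.deriv_eq]; simp
  have z' : ∀ f : ℝ → ℝ, (∀ x, x ∉ Set.Icc (s - 1) s → f x = 0) →
      ∃ c c', (∀ x, x < s - 1 → f x = c) ∧ ∀ x, s < x → f x = c' := fun f hf =>
    ⟨0, 0, fun x hx => hf x fun h => by linarith [h.1], fun x hx => hf x fun h => by linarith [h.2]⟩
  have z1 := z h ⟨1, 0, fun x hx => Real.smoothTransition.one_of_one_le (by linarith),
    fun x hx => Real.smoothTransition.zero_of_nonpos (by linarith)⟩
  have z2 := z _ (z' _ z1)
  have z3 := z _ (z' _ z2)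
  obtain ⟨C1, hC1⟩ := abs_bounded_of_eq_zero_off_Icc hs1.continuous z1
  obtain ⟨C2, hC2⟩ := abs_bounded_of_eq_zero_off_Icc hs2.continuous z2
  obtain ⟨C3, hC3⟩ := abs_bounded_of_eq_zero_off_Icc hs3.continuous z3
  have hn : ∀ x, 0 ≤ h x := fun x => Real.smoothTransition.nonneg _
  have hanti : Antitone h := fun x y hxy => Real.smoothTransition.monotone (by linarith)
  have hle : ∀ x, h x ≤ 1 := fun x => Real.smoothTransition.le_one _
  set C := max (max 1 C1) (max C2 C3)
  have e1 : (1 : ℝ) ≤ C := (le_max_left _ _).trans (le_max_left _ _)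
  have e2 : C1 ≤ C := (le_max_right _ _).trans (le_max_left _ _)
  have e3 : C2 ≤ C := (le_max_left _ _).trans (le_max_right _ _)
  have e4 : C3 ≤ C := (le_max_right _ _).trans (le_max_right _ _)
  obtain ⟨G, H, C', hj⟩ := SlepianJet.exists_prod (ι := ι) (h := h) e1
    (fun x => (hs.differentiable (by norm_num) x).hasDerivAt)
    (fun x => (hs1.differentiable (by norm_num) x).hasDerivAt)
    (fun x => (hs2.differentiable (by norm_num) x).hasDerivAt)
    (fun x => by rw [abs_of_nonneg (hn x)]; exact (hle x).trans e1)
    (fun x => (hC1 x).trans e2) (fun x => (hC2 x).trans e3) (fun x => (hC3 x).trans e4)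
    hn (fun x => hanti.deriv_nonpos) Finset.univ
  refine ⟨_, G, H, C', hj, fun v => Finset.prod_le_one (fun i _ => hn _) fun i _ => hle _,
    fun v hv => Finset.prod_eq_one fun i _ =>
      Real.smoothTransition.one_of_one_le (by linarith [hv i]), ?_⟩
  rintro v ⟨i, hi⟩
  exact Finset.prod_eq_zero (Finset.mem_univ i)
    (Real.smoothTransition.zero_of_nonpos (by linarith))

/-! ### Lindeberg replacement and Slepian's inequality. -/

/-- The law of `c • X` for a random vector `X` of law `μ`. -/
noncomputable def scaledLaw {ι : Type*} (μ : Measure (ι → ℝ)) (c : ℝ) : Measure (ι → ℝ) :=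
  μ.map (fun x => c • x)

section Scaled

variable {ι : Type*}

instance (μ : Measure (ι → ℝ)) [IsProbabilityMeasure μ] (c : ℝ) :
    IsProbabilityMeasure (scaledLaw μ c) :=
  Measure.isProbabilityMeasure_map (by fun_prop)

lemma scaledLaw_one (μ : Measure (ι → ℝ)) : scaledLaw μ 1 = μ := by
  simp [scaledLaw]

lemma scaledLaw_zero (μ : Measure (ι → ℝ)) [IsProbabilityMeasure μ] :
    scaledLaw μ 0 = Measure.dirac 0 := by
  simp [scaledLaw, Measure.map_const]

lemma integral_scaledLaw (μ : Measure (ι → ℝ)) (c : ℝ) {F : (ι → ℝ) → ℝ} (hF : Measurable F) :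
    ∫ x, F x ∂(scaledLaw μ c) = ∫ x, F (c • x) ∂μ :=
  integral_map (by fun_prop) hF.aestronglyMeasurable

lemma charFunDual_scaledLaw [Fintype ι] (μ : Measure (ι → ℝ)) [IsGaussian μ] (h0 : ∫ x, x ∂μ = 0) (c : ℝ)
    (L : StrongDual ℝ (ι → ℝ)) :
    charFunDual (scaledLaw μ c) L = Complex.exp (-(c ^ 2 * Var[L; μ] : ℝ) / 2) := by
  have e : (fun x : ι → ℝ => c • x) = (c • ContinuousLinearMap.id ℝ (ι → ℝ) : _ →L[ℝ] _) := by
    ext; simp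
  rw [scaledLaw, e, charFunDual_map, IsGaussian.charFunDual_eq_of_integral_eq_zero (by simpa using h0)]
  congr 3
  rw [← variance_const_mul]
  norm_cast
  congr 1
  ext x
  simp

/-- Variances add in the characteristic functions. This divisibility allows a Gaussian law to be
split into many small independent pieces. -/
lemma scaledLaw_conv_scaledLaw [Fintype ι] (μ : Measure (ι → ℝ)) [IsGaussian μ] (h0 : ∫ x, x ∂μ = 0)
    {a b c : ℝ} (habc : a ^ 2 + b ^ 2 = c ^ 2) :
    scaledLaw μ a ∗ scaledLaw μ b = scaledLaw μ c := by
  refine Measure.ext_of_charFunDual (funext fun L => ?_)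
  rw [charFunDual_conv, charFunDual_scaledLaw μ h0, charFunDual_scaledLaw μ h0,
    charFunDual_scaledLaw μ h0, ← Complex.exp_add, ← habc]
  congr 1
  push_cast
  ring

end Scaled

namespace SlepianJet

variable {ι : Type*} [Fintype ι] {F : (ι → ℝ) → ℝ} {G : ι → (ι → ℝ) → ℝ}
  {H : ι → ι → (ι → ℝ) → ℝ} {C : ℝ}

lemma integrable (h : SlepianJet F G H C) {α : Type*} [MeasurableSpace α] (μ : Measure α)
    [IsFiniteMeasure μ] {f : α → ι → ℝ} (hf : Measurable f) : Integrable (fun x => F (f x)) μ :=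
  Integrable.of_bound (h.measurable.comp hf).aestronglyMeasurable C
    (Filter.Eventually.of_forall fun _ => h.bound _)

/-- The linear Taylor term integrates to zero because the mean is zero, so only covariances matter
up to third order. -/
lemma abs_integral_sub_le (h : SlepianJet F G H C) (μ : Measure (ι → ℝ)) [IsProbabilityMeasure μ]
    (hμ1 : ∀ i, Integrable (fun w : ι → ℝ => w i) μ) (hμ0 : ∀ i, ∫ w, w i ∂μ = 0)
    (hμ2 : ∀ i j, Integrable (fun w : ι → ℝ => w i * w j) μ)
    (hμ3 : Integrable (fun w : ι → ℝ => ‖w‖ ^ 3) μ) {ε : ℝ} (hε : 0 ≤ ε) (v : ι → ℝ) :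
    |∫ w, F (v + ε • w) ∂μ - F v - 1 / 2 * (ε ^ 2 * ∑ i, ∑ j, H i j v * ∫ w, w i * w j ∂μ)|
      ≤ C * ε ^ 3 * ∫ w, ‖w‖ ^ 3 ∂μ := by
  have i1 : Integrable (fun w : ι → ℝ => ∑ i, G i v * (ε • w) i) μ :=
    integrable_finsetSum _ fun i _ => by
      simpa using ((hμ1 i).const_mul ε).const_mul (G i v)
  have i2' : ∀ i j, Integrable (fun w : ι → ℝ => H i j v * ((ε • w) i * (ε • w) j)) μ :=
    fun i j => by
      have := ((hμ2 i j).const_mul (ε ^ 2)).const_mul (H i j v)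
      refine this.congr (Filter.Eventually.of_forall fun w => ?_)
      simp only [Pi.smul_apply, smul_eq_mul]
      ring
  have i2 : Integrable (fun w : ι → ℝ => ∑ i, ∑ j, H i j v * ((ε • w) i * (ε • w) j)) μ :=
    integrable_finsetSum _ fun i _ => integrable_finsetSum _ fun j _ => i2' i j
  have i0 : Integrable (fun w : ι → ℝ => F (v + ε • w)) μ := h.integrable μ (by fun_prop)
  have e1 : ∫ w, ∑ i, G i v * (ε • w) i ∂μ = 0 := by
    rw [integral_finsetSum _ fun i _ => by simpa using ((hμ1 i).const_mul ε).const_mul (G i v)]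
    refine Finset.sum_eq_zero fun i _ => ?_
    simp [integral_const_mul, hμ0 i]
  have e2 : ∫ w, ∑ i, ∑ j, H i j v * ((ε • w) i * (ε • w) j) ∂μ
      = ε ^ 2 * ∑ i, ∑ j, H i j v * ∫ w, w i * w j ∂μ := by
    rw [integral_finsetSum _ fun i _ => integrable_finsetSum _ fun j _ => i2' i j, Finset.mul_sum]
    refine Finset.sum_congr rfl fun i _ => ?_
    rw [integral_finsetSum _ fun j _ => i2' i j, Finset.mul_sum]
    refine Finset.sum_congr rfl fun j _ => ?_
    rw [← integral_const_mul, ← integral_const_mul]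
    refine integral_congr_ae (Filter.Eventually.of_forall fun w => ?_)
    simp only [Pi.smul_apply, smul_eq_mul]
    ring
  have key : ∫ w, F (v + ε • w) ∂μ - F v
      - 1 / 2 * (ε ^ 2 * ∑ i, ∑ j, H i j v * ∫ w, w i * w j ∂μ)
      = ∫ w, (F (v + ε • w) - F v - ∑ i, G i v * (ε • w) i
        - (1 / 2) * ∑ i, ∑ j, H i j v * ((ε • w) i * (ε • w) j)) ∂μ := by
    have i3 : Integrable (fun w : ι → ℝ => F (v + ε • w) - F v) μ := i0.sub (integrable_const _)
    have i4 : Integrable (fun w : ι → ℝ => F (v + ε • w) - F v - ∑ i, G i v * (ε • w) i) μ :=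
      i3.sub i1
    rw [integral_sub i4 (i2.const_mul _), integral_sub i3 i1, integral_sub i0 (integrable_const _),
      integral_const_mul, e1, e2]
    simp
  rw [key, ← integral_const_mul]
  refine (abs_integral_le_integral_abs).trans (integral_mono_of_nonneg
    (Filter.Eventually.of_forall fun _ => abs_nonneg _) (hμ3.const_mul _)
    (Filter.Eventually.of_forall fun w => (h.taylor_two v (ε • w)).trans_eq ?_))
  rw [norm_smul, Real.norm_of_nonneg hε]
  ring

end SlepianJet

section Gaussian

variable {ι : Type*} [Fintype ι]

lemma IsGaussian.integrable_norm_pow (μ : Measure (ι → ℝ)) [IsGaussian μ] (k : ℕ) :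
    Integrable (fun w => ‖w‖ ^ k) μ := by
  have := (IsGaussian.memLp_id μ (k : ENNReal) (by simp)).integrable_norm_pow'
  simpa using this

lemma IsGaussian.integrable_coord (μ : Measure (ι → ℝ)) [IsGaussian μ] (i : ι) :
    Integrable (fun w : ι → ℝ => w i) μ := by
  refine (integrable_norm_pow μ 1).mono' (measurable_pi_apply i).aestronglyMeasurable
    (Filter.Eventually.of_forall fun w => ?_)
  simpa using norm_le_pi_norm w i

lemma IsGaussian.integrable_coord_mul_coord (μ : Measure (ι → ℝ)) [IsGaussian μ] (i j : ι) :
    Integrable (fun w : ι → ℝ => w i * w j) μ := by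
  refine (integrable_norm_pow μ 2).mono' (by fun_prop) (Filter.Eventually.of_forall fun w => ?_)
  rw [norm_mul, pow_two]
  gcongr
  exacts [norm_le_pi_norm w i, norm_le_pi_norm w j]

lemma IsGaussian.integral_eq_zero_of_coord (μ : Measure (ι → ℝ)) [IsGaussian μ]
    (h : ∀ i, ∫ w, w i ∂μ = 0) : ∫ w, w ∂μ = 0 := by
  ext i
  rw [eval_integral fun i => IsGaussian.integrable_coord μ i, h i]
  rfl

/-- One Lindeberg step: replacing an independent small multiple of `μ` by the same multiple of `ν`
decreases a jet by at most a term of third order. -/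
lemma SlepianJet.integral_conv_le {F : (ι → ℝ) → ℝ} {G : ι → (ι → ℝ) → ℝ}
    {H : ι → ι → (ι → ℝ) → ℝ} {C : ℝ} (h : SlepianJet F G H C) (μ ν : Measure (ι → ℝ))
    [IsGaussian μ] [IsGaussian ν] (hμ : ∀ i, ∫ w, w i ∂μ = 0) (hν : ∀ i, ∫ w, w i ∂ν = 0)
    (hd : ∀ i, ∫ w, w i * w i ∂μ = ∫ w, w i * w i ∂ν)
    (ho : ∀ i j, i ≠ j → ∫ w, w i * w j ∂μ ≤ ∫ w, w i * w j ∂ν)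
    (κ : Measure (ι → ℝ)) [IsProbabilityMeasure κ] {ε : ℝ} (hε : 0 ≤ ε) :
    ∫ x, F x ∂(κ ∗ scaledLaw μ ε)
      ≤ ∫ x, F x ∂(κ ∗ scaledLaw ν ε)
        + C * ε ^ 3 * (∫ w, ‖w‖ ^ 3 ∂μ + ∫ w, ‖w‖ ^ 3 ∂ν) := by
  have hc : ∀ (ρ : Measure (ι → ℝ)) [IsGaussian ρ],
      ∫ x, F x ∂(κ ∗ scaledLaw ρ ε) = ∫ v, ∫ w, F (v + ε • w) ∂ρ ∂κ := fun ρ _ => by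
    rw [integral_conv (show Integrable F _ from h.integrable _ measurable_id)]
    refine integral_congr_ae (Filter.Eventually.of_forall fun v => ?_)
    exact integral_scaledLaw ρ ε (h.measurable.comp (measurable_const_add v))
  have hi : ∀ (ρ : Measure (ι → ℝ)) [IsGaussian ρ],
      Integrable (fun v => ∫ w, F (v + ε • w) ∂ρ) κ := fun ρ _ =>
    (h.integrable (κ.prod ρ) (f := fun p => p.1 + ε • p.2) (by fun_prop)).integral_prod_left
  rw [hc, hc]
  have hp : ∀ v, ∫ w, F (v + ε • w) ∂μ ≤ ∫ w, F (v + ε • w) ∂ν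
      + C * ε ^ 3 * (∫ w, ‖w‖ ^ 3 ∂μ + ∫ w, ‖w‖ ^ 3 ∂ν) := fun v => by
    have a := abs_le.1 (h.abs_integral_sub_le μ (IsGaussian.integrable_coord μ) hμ
      (IsGaussian.integrable_coord_mul_coord μ) (IsGaussian.integrable_norm_pow μ 3) hε v)
    have b := abs_le.1 (h.abs_integral_sub_le ν (IsGaussian.integrable_coord ν) hν
      (IsGaussian.integrable_coord_mul_coord ν) (IsGaussian.integrable_norm_pow ν 3) hε v)
    have hs : ∑ i, ∑ j, H i j v * ∫ w, w i * w j ∂μ ≤ ∑ i, ∑ j, H i j v * ∫ w, w i * w j ∂ν := by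
      refine Finset.sum_le_sum fun i _ => Finset.sum_le_sum fun j _ => ?_
      by_cases hij : i = j
      · subst hij
        rw [hd]
      · exact mul_le_mul_of_nonneg_left (ho i j hij) (h.offDiag_nonneg i j hij v)
    have := mul_le_mul_of_nonneg_left hs (sq_nonneg ε)
    linarith [a.1, a.2, b.1, b.2]
  calc _ ≤ ∫ v, (∫ w, F (v + ε • w) ∂ν + C * ε ^ 3 * (∫ w, ‖w‖ ^ 3 ∂μ + ∫ w, ‖w‖ ^ 3 ∂ν)) ∂κ :=
      integral_mono (hi μ) ((hi ν).add (integrable_const _)) hp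
    _ = _ := by
      rw [integral_add (hi ν) (integrable_const _)]
      simp

/-- Both laws are cut into `N` independent pieces of scale `ε = N^(-1/2)`, exchanged one at a time.
Each exchange costs at most `C m ε³`, so the total is `C m N^(-1/2)`, which tends to zero. -/
lemma SlepianJet.integral_le {F : (ι → ℝ) → ℝ} {G : ι → (ι → ℝ) → ℝ}
    {H : ι → ι → (ι → ℝ) → ℝ} {C : ℝ} (h : SlepianJet F G H C) (μ ν : Measure (ι → ℝ))
    [IsGaussian μ] [IsGaussian ν] (hμ : ∀ i, ∫ w, w i ∂μ = 0) (hν : ∀ i, ∫ w, w i ∂ν = 0)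
    (hd : ∀ i, ∫ w, w i * w i ∂μ = ∫ w, w i * w i ∂ν)
    (ho : ∀ i j, i ≠ j → ∫ w, w i * w j ∂μ ≤ ∫ w, w i * w j ∂ν) :
    ∫ x, F x ∂μ ≤ ∫ x, F x ∂ν := by
  set m := ∫ w, ‖w‖ ^ 3 ∂μ + ∫ w, ‖w‖ ^ 3 ∂ν with hm
  have h0μ := IsGaussian.integral_eq_zero_of_coord μ hμ
  have h0ν := IsGaussian.integral_eq_zero_of_coord ν hν
  have bound : ∀ N : ℕ, 0 < N → ∫ x, F x ∂μ ≤ ∫ x, F x ∂ν + C * m * (√(1 / N)) := by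
    intro N hN
    have hN' : (0 : ℝ) < N := by exact_mod_cast hN
    set ε := √(1 / N : ℝ) with hε
    have hε2 : ε ^ 2 = 1 / N := Real.sq_sqrt (by positivity)
    have step : ∀ k : ℕ, k ≤ N → ∫ x, F x ∂μ
        ≤ ∫ x, F x ∂(scaledLaw μ √(1 - k / N) ∗ scaledLaw ν √(k / N)) + k * (C * ε ^ 3 * m) := by
      intro k
      induction k with
      | zero =>
        intro _
        simp [scaledLaw_zero, scaledLaw_one]
      | succ k ih =>
        intro hk
        refine (ih (by omega)).trans ?_
        have hk' : (k : ℝ) + 1 ≤ N := by exact_mod_cast hk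
        have e1 : scaledLaw μ √(1 - k / N)
            = scaledLaw μ √(1 - (k + 1 : ℕ) / N) ∗ scaledLaw μ ε := by
          rw [scaledLaw_conv_scaledLaw μ h0μ]
          rw [hε2, Real.sq_sqrt, Real.sq_sqrt]
          · push_cast; field_simp; ring
          · rw [sub_nonneg, div_le_one hN']; linarith
          · rw [sub_nonneg, div_le_one hN']; push_cast; linarith
        have e2 : scaledLaw ν √((k + 1 : ℕ) / N) = scaledLaw ν √(k / N) ∗ scaledLaw ν ε := by
          rw [scaledLaw_conv_scaledLaw ν h0ν]
          rw [hε2, Real.sq_sqrt (by positivity), Real.sq_sqrt (by positivity)]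
          push_cast; field_simp
        -- Everything but the exchanged piece serves as the common independent part; commuting the
        -- convolutions detaches that piece from `μ` and merges its replacement into `ν`.
        have := h.integral_conv_le μ ν hμ hν hd ho
          (scaledLaw μ √(1 - (k + 1 : ℕ) / N) ∗ scaledLaw ν √(k / N)) (Real.sqrt_nonneg (1 / N))
        rw [Measure.conv_assoc, Measure.conv_assoc, Measure.conv_comm (scaledLaw ν _),
          ← Measure.conv_assoc, ← e1, ← e2] at this
        push_cast at this ⊢
        linarith
    have := step N le_rfl
    rw [div_self hN'.ne', sub_self, Real.sqrt_zero, Real.sqrt_one, scaledLaw_zero, scaledLaw_one,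
      Measure.dirac_zero_conv] at this
    refine this.trans_eq ?_
    have : (N : ℝ) * ε ^ 2 = 1 := by rw [hε2]; field_simp
    linear_combination C * ε * m * this
  have lim : Filter.Tendsto (fun N : ℕ => ∫ x, F x ∂ν + C * m * √(1 / N)) Filter.atTop
      (nhds (∫ x, F x ∂ν + C * m * √0)) :=
    (((tendsto_one_div_atTop_nhds_zero_nat (𝕜 := ℝ)).sqrt).const_mul _).const_add _
  rw [Real.sqrt_zero, mul_zero, add_zero] at lim
  exact ge_of_tendsto lim (by
    filter_upwards [Filter.eventually_gt_atTop 0] with N hN using bound N hN)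

/-- **Slepian's inequality** for the maxima of centered Gaussian vectors with equal variances, up to
a unit shift. -/
theorem slepian_shift (μ ν : Measure (ι → ℝ))
    [IsGaussian μ] [IsGaussian ν] (hμ : ∀ i, ∫ w, w i ∂μ = 0) (hν : ∀ i, ∫ w, w i ∂ν = 0)
    (hd : ∀ i, ∫ w, w i * w i ∂μ = ∫ w, w i * w i ∂ν)
    (ho : ∀ i j, i ≠ j → ∫ w, w i * w j ∂μ ≤ ∫ w, w i * w j ∂ν) (s : ℝ) :
    μ {x | ∀ i, x i ≤ s - 1} ≤ ν {x | ∀ i, x i < s} := by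
  obtain ⟨F, G, H, C, h, hle, h1, h0⟩ := exists_slepianJet_cutoff ι s
  have m1 : MeasurableSet {x : ι → ℝ | ∀ i, x i ≤ s - 1} := by measurability
  have m2 : MeasurableSet {x : ι → ℝ | ∀ i, x i < s} := by measurability
  refine (ENNReal.toReal_le_toReal (measure_ne_top _ _) (measure_ne_top _ _)).1 ?_
  calc μ.real {x | ∀ i, x i ≤ s - 1}
      = ∫ x, {x : ι → ℝ | ∀ i, x i ≤ s - 1}.indicator 1 x ∂μ := by simp [integral_indicator_one m1]
    _ ≤ ∫ x, F x ∂μ := by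
      refine integral_mono ((integrable_const 1).indicator m1) (h.integrable μ measurable_id) ?_
      intro x
      refine Set.indicator_apply_le' (fun hx => ?_) fun _ => h.nonneg x
      simp [h1 x hx]
    _ ≤ ∫ x, F x ∂ν := h.integral_le μ ν hμ hν hd ho
    _ ≤ ∫ x, {x : ι → ℝ | ∀ i, x i < s}.indicator 1 x ∂ν := by
      refine integral_mono (h.integrable ν measurable_id) ((integrable_const 1).indicator m2) ?_
      intro x
      by_cases hx : ∀ i, x i < s
      · rw [Set.indicator_of_mem (show x ∈ {x : ι → ℝ | ∀ i, x i < s} from hx)]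
        exact hle x
      · rw [Set.indicator_of_notMem (show x ∉ {x : ι → ℝ | ∀ i, x i < s} from hx)]
        push Not at hx
        exact (h0 x hx).le
    _ = ν.real {x | ∀ i, x i < s} := by simp [integral_indicator_one m2]

end Gaussian

/-! ### Estimates for the standard normal distribution. -/

section StdGaussian

/-- The value at `0` of the standard normal density. -/
noncomputable def stdNormalPeak : ℝ := (√(2 * Real.pi))⁻¹

lemma stdNormalPeak_pos : 0 < stdNormalPeak := by
  unfold stdNormalPeak; positivity

lemma stdNormalPeak_sq : stdNormalPeak ^ 2 = 1 / (2 * Real.pi) := by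
  rw [stdNormalPeak, inv_pow, Real.sq_sqrt (by positivity), one_div]

lemma gaussianPDFReal_std (x : ℝ) :
    gaussianPDFReal 0 1 x = stdNormalPeak * Real.exp (-(x ^ 2 / 2)) := by
  simp [gaussianPDFReal, stdNormalPeak, neg_div]

lemma continuous_gaussianPDFReal_std : Continuous (gaussianPDFReal 0 1) := by
  rw [show gaussianPDFReal 0 1 = fun x => stdNormalPeak * Real.exp (-(x ^ 2 / 2)) from
    funext gaussianPDFReal_std]
  fun_prop

lemma gaussianReal_std_real_eq (s : Set ℝ) :
    (gaussianReal 0 1).real s = ∫ x in s, gaussianPDFReal 0 1 x := by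
  rw [Measure.real, gaussianReal_apply_eq_integral 0 one_ne_zero s, ENNReal.toReal_ofReal]
  exact integral_nonneg fun x => gaussianPDFReal_nonneg 0 1 x

lemma gaussianReal_std_Ici_eq_Iic_neg (x : ℝ) :
    (gaussianReal 0 1).real (Set.Ici x) = (gaussianReal 0 1).real (Set.Iic (-x)) := by
  have h : (gaussianReal 0 1).map (fun x => -x) = gaussianReal 0 1 := by
    simpa using gaussianReal_map_neg (μ := 0) (v := 1)
  nth_rewrite 1 [← h]
  rw [map_measureReal_apply (by fun_prop) measurableSet_Ici]
  congr 1
  ext y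
  simp

lemma gaussianReal_std_Iic_sub (x y : ℝ) :
    (gaussianReal 0 1).real (Set.Iic y) - (gaussianReal 0 1).real (Set.Iic x)
      = ∫ t in x..y, gaussianPDFReal 0 1 t := by
  rw [gaussianReal_std_real_eq, gaussianReal_std_real_eq]
  exact intervalIntegral.integral_Iic_sub_Iic (integrable_gaussianPDFReal 0 1).integrableOn
    (integrable_gaussianPDFReal 0 1).integrableOn

lemma gaussianReal_std_Iic_zero : (gaussianReal 0 1).real (Set.Iic 0) = 1 / 2 := by
  have h1 := gaussianReal_std_Ici_eq_Iic_neg 0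
  have : NullSingletonClass (gaussianReal 0 1) := nullSingletonClass_gaussianReal one_ne_zero
  have h2 : (gaussianReal 0 1).real (Set.Ici 0) = (gaussianReal 0 1).real (Set.Iic 0)ᶜ := by
    rw [Set.compl_Iic]
    exact measureReal_congr Ioi_ae_eq_Ici.symm
  rw [h2, probReal_compl_eq_one_sub measurableSet_Iic, neg_zero] at h1
  linarith

lemma hasDerivAt_gaussianReal_std_Iic (y : ℝ) :
    HasDerivAt (fun y => (gaussianReal 0 1).real (Set.Iic y)) (gaussianPDFReal 0 1 y) y := by
  have h : (fun y => (gaussianReal 0 1).real (Set.Iic y))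
      = fun y => (1 / 2 : ℝ) + ∫ t in (0 : ℝ)..y, gaussianPDFReal 0 1 t := by
    funext y
    rw [← gaussianReal_std_Iic_sub, gaussianReal_std_Iic_zero]
    ring
  rw [h]
  exact (intervalIntegral.integral_hasDerivAt_right
    (continuous_gaussianPDFReal_std.intervalIntegrable _ _)
    continuous_gaussianPDFReal_std.stronglyMeasurable.stronglyMeasurableAtFilter
    continuous_gaussianPDFReal_std.continuousAt).const_add _

lemma tendsto_gaussianReal_std_Iic_atBot :
    Filter.Tendsto (fun y => (gaussianReal 0 1).real (Set.Iic y)) Filter.atBot (nhds 0) := by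
  have := tendsto_cdf_atBot (gaussianReal 0 1)
  exact this.congr fun y => cdf_eq_real _ y

/-- The tangent bound for the standard normal distribution function given by its log-concavity. -/
lemma gaussianReal_std_Iic_le_exp (y : ℝ) :
    (gaussianReal 0 1).real (Set.Iic y) ≤ 1 / 2 * Real.exp (2 * stdNormalPeak * y) := by
  set p := stdNormalPeak with hp
  have hp0 : 0 < p := stdNormalPeak_pos
  set Φ : ℝ → ℝ := fun y => (gaussianReal 0 1).real (Set.Iic y) with hΦ
  set g : ℝ → ℝ := fun y => 1 / 2 * Real.exp (2 * p * y) - Φ y with hg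
  have hgd : ∀ y, HasDerivAt g (p * (Real.exp (2 * p * y) - Real.exp (-(y ^ 2 / 2)))) y := by
    intro y
    have := ((((hasDerivAt_id y).const_mul (2 * p)).exp).const_mul (1 / 2)).sub
      (hasDerivAt_gaussianReal_std_Iic y)
    refine this.congr_deriv ?_
    rw [gaussianPDFReal_std]
    simp only [id]
    ring
  have hgc : Continuous g := continuous_iff_continuousAt.2 fun x => (hgd x).continuousAt
  have hg0 : g 0 = 0 := by simp [hg, hΦ, gaussianReal_std_Iic_zero]
  suffices 0 ≤ g y by simpa [hg] using this
  rcases le_total 0 y with hy | hy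
  -- For `y ≥ 0` the density is at most `p`, so `Φ y ≤ 1/2 + p y`, and `1 + u ≤ exp u` concludes.
  · have h1 : Φ y - Φ 0 ≤ p * y := by
      simp only [hΦ]
      rw [gaussianReal_std_Iic_sub]
      calc ∫ t in (0 : ℝ)..y, gaussianPDFReal 0 1 t ≤ ∫ _ in (0 : ℝ)..y, p := by
            refine intervalIntegral.integral_mono_on hy
              (continuous_gaussianPDFReal_std.intervalIntegrable _ _) (by simp) fun t _ => ?_
            rw [gaussianPDFReal_std]
            refine mul_le_of_le_one_right hp0.le (Real.exp_le_one_iff.2 ?_)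
            have := sq_nonneg t
            linarith
        _ = p * y := by simp [mul_comm]
    have h2 : Φ 0 = 1 / 2 := gaussianReal_std_Iic_zero
    have h3 := Real.add_one_le_exp (2 * p * y)
    simp only [hg]
    linarith
  -- The sign of `g'` is that of `y (y + 4p)`: on the negative axis `g` rises from its limit 0 at
  -- `-∞` up to `-4p`, then falls back to `g 0 = 0`.
  rcases le_total (-(4 * p)) y with hy' | hy'
  · have : AntitoneOn g (Set.Icc (-(4 * p)) 0) := by
      refine antitoneOn_of_deriv_nonpos (convex_Icc _ _) hgc.continuousOn
        (fun x _ => (hgd x).differentiableAt.differentiableWithinAt) fun x hx => ?_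
      rw [interior_Icc] at hx
      rw [(hgd x).deriv]
      refine mul_nonpos_of_nonneg_of_nonpos hp0.le (sub_nonpos.2 (Real.exp_le_exp.2 ?_))
      nlinarith [hx.1, hx.2]
    rw [← hg0]
    exact this ⟨hy', hy⟩ ⟨by linarith, le_rfl⟩ hy
  · have hm : MonotoneOn g (Set.Iic (-(4 * p))) := by
      refine monotoneOn_of_deriv_nonneg (convex_Iic _) hgc.continuousOn
        (fun x _ => (hgd x).differentiableAt.differentiableWithinAt) fun x hx => ?_
      rw [interior_Iic, Set.mem_Iio] at hx
      rw [(hgd x).deriv]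
      refine mul_nonneg hp0.le (sub_nonneg.2 (Real.exp_le_exp.2 ?_))
      nlinarith
    have lim : Filter.Tendsto g Filter.atBot (nhds 0) := by
      have h1 : Filter.Tendsto (fun y => 1 / 2 * Real.exp (2 * p * y)) Filter.atBot (nhds 0) := by
        have := (Real.tendsto_exp_atBot.comp
          (Filter.tendsto_id.const_mul_atBot (show 0 < 2 * p by positivity))).const_mul (1 / 2)
        simpa using this
      simpa [hg, hΦ] using h1.sub tendsto_gaussianReal_std_Iic_atBot
    refine le_of_tendsto lim ?_
    filter_upwards [Filter.eventually_le_atBot y] with x hx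
    exact hm (Set.mem_Iic.2 (hx.trans hy')) hy' hx

/-- Bernoulli's inequality with exponent `κ / (2p) ≥ 1` turns the tangent bound of rate `2p` into
one affine in `exp (κ y)`, so that an exponential moment of any larger order can be used. -/
lemma gaussianReal_std_Iic_le_of_le {κ : ℝ} (hκ : 2 * stdNormalPeak ≤ κ) (y : ℝ) :
    (gaussianReal 0 1).real (Set.Iic y)
      ≤ 1 / 2 + stdNormalPeak / κ * (Real.exp (κ * y) - 1) := by
  have hp0 := stdNormalPeak_pos
  have hκ0 : 0 < κ := by linarith
  set q := 2 * stdNormalPeak with hq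
  have hq0 : q ≠ 0 := by positivity
  have hb := one_add_mul_self_le_rpow_one_add (s := Real.exp (q * y) - 1)
    (by linarith [Real.exp_pos (q * y)]) (p := κ / q) (by rw [one_le_div (by linarith)]; exact hκ)
  rw [add_sub_cancel, ← Real.exp_mul, show q * y * (κ / q) = κ * y by field_simp] at hb
  have := gaussianReal_std_Iic_le_exp y
  have h2 : stdNormalPeak / κ * (κ / q * (Real.exp (q * y) - 1))
      ≤ stdNormalPeak / κ * (Real.exp (κ * y) - 1) := by
    gcongr
    linarith
  have h3 : stdNormalPeak / κ * (κ / q * (Real.exp (q * y) - 1))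
      = 1 / 2 * (Real.exp (q * y) - 1) := by
    rw [hq]; field_simp
  linarith

/-- The density on `[r, r + 1]` is at least its value at `r + 1`. -/
lemma le_gaussianReal_std_Ici {r : ℝ} (hr : 0 ≤ r) :
    stdNormalPeak * Real.exp (-((r + 1) ^ 2 / 2)) ≤ (gaussianReal 0 1).real (Set.Ici r) := by
  have h : (gaussianReal 0 1).real (Set.Iic (r + 1)) - (gaussianReal 0 1).real (Set.Iic r)
      ≤ (gaussianReal 0 1).real (Set.Ici r) := by
    rw [sub_le_iff_le_add']
    exact (measureReal_mono (s₂ := Set.Iic r ∪ Set.Ici r) (by simp)).trans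
      (measureReal_union_le _ _)
  refine le_trans ?_ h
  rw [gaussianReal_std_Iic_sub]
  calc stdNormalPeak * Real.exp (-((r + 1) ^ 2 / 2))
      = ∫ _ in r..(r + 1), stdNormalPeak * Real.exp (-((r + 1) ^ 2 / 2)) := by simp
    _ ≤ _ := by
      refine intervalIntegral.integral_mono_on (by linarith) (by simp)
        (continuous_gaussianPDFReal_std.intervalIntegrable _ _) fun t ht => ?_
      rw [gaussianPDFReal_std]
      have := ht.1
      have := ht.2
      refine mul_le_mul_of_nonneg_left (Real.exp_le_exp.2 ?_) stdNormalPeak_pos.le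
      nlinarith

/-- The Mills ratio bound for the upper tail of the standard normal distribution. -/
lemma gaussianReal_std_Ici_le {x : ℝ} (hx : 0 < x) :
    (gaussianReal 0 1).real (Set.Ici x) ≤ stdNormalPeak * Real.exp (-(x ^ 2 / 2)) / x := by
  have hd : ∀ y, HasDerivAt (fun y => -(stdNormalPeak * Real.exp (-(y ^ 2 / 2))))
      (y * gaussianPDFReal 0 1 y) y := by
    intro y
    have := (((((hasDerivAt_id y).pow 2).div_const 2).neg.exp).const_mul stdNormalPeak).neg
    refine this.congr_deriv ?_
    rw [gaussianPDFReal_std]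
    simp
    ring
  have lim : Filter.Tendsto (fun y => -(stdNormalPeak * Real.exp (-(y ^ 2 / 2)))) Filter.atTop
      (nhds 0) := by
    have h1 : Filter.Tendsto (fun y : ℝ => y ^ 2 / 2) Filter.atTop Filter.atTop :=
      (Filter.tendsto_pow_atTop two_ne_zero).atTop_div_const two_pos
    have := ((Real.tendsto_exp_neg_atTop_nhds_zero.comp h1).const_mul stdNormalPeak).neg
    simpa using this
  have hpos : ∀ y ∈ Set.Ioi x, 0 ≤ y * gaussianPDFReal 0 1 y := fun y hy =>
    mul_nonneg (hx.trans hy).le (gaussianPDFReal_nonneg 0 1 y)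
  have hint := integrableOn_Ioi_deriv_of_nonneg' (fun y _ => hd y) hpos lim
  have hval := integral_Ioi_of_hasDerivAt_of_nonneg' (fun y _ => hd y) hpos lim
  rw [gaussianReal_std_real_eq, integral_Ici_eq_integral_Ioi, le_div_iff₀ hx,
    ← integral_mul_const]
  calc ∫ y in Set.Ioi x, gaussianPDFReal 0 1 y * x
      ≤ ∫ y in Set.Ioi x, y * gaussianPDFReal 0 1 y := by
        refine setIntegral_mono_on ((integrable_gaussianPDFReal 0 1).integrableOn.mul_const x) hint
          measurableSet_Ioi fun y hy => ?_
        rw [mul_comm]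
        exact mul_le_mul_of_nonneg_right (le_of_lt hy) (gaussianPDFReal_nonneg 0 1 y)
    _ = _ := by rw [hval]; ring

lemma integral_abs_gaussianReal_std_le : ∫ x, |x| ∂(gaussianReal 0 1) ≤ 1 := by
  have h2 : ∫ x, x ^ 2 ∂(gaussianReal 0 1) = 1 := by
    have := variance_fun_id_gaussianReal (μ := 0) (v := 1)
    rw [variance_eq_integral (by fun_prop)] at this
    simpa using this
  have hi2 : Integrable (fun x : ℝ => x ^ 2) (gaussianReal 0 1) := by
    simpa using (memLp_id_gaussianReal (μ := 0) (v := 1) 2).integrable_sq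
  have hi1 : Integrable (fun x : ℝ => |x|) (gaussianReal 0 1) := by
    have := (memLp_id_gaussianReal (μ := 0) (v := 1) 1).integrable (by norm_num)
    exact this.abs
  have : ∫ x, |x| ∂(gaussianReal 0 1) ≤ ∫ x, (1 / 2 + 1 / 2 * x ^ 2) ∂(gaussianReal 0 1) := by
    refine integral_mono hi1 ((integrable_const _).add (hi2.const_mul _)) fun x => ?_
    have := sq_nonneg (|x| - 1)
    simp only
    nlinarith [sq_abs x]
  rw [integral_add (integrable_const _) (hi2.const_mul _), integral_const_mul, h2] at this
  simp at this
  linarith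

end StdGaussian

/-- If `V` is standard normal and independent of `W`, and `W` has an exponential moment of order at
least `√(2 / π)` less than one, then `V + W` is nonnegative with probability less than `1 / 2`. -/
lemma measureReal_nonneg_add_lt_half {Ω : Type*} [MeasurableSpace Ω] {P : Measure Ω}
    [IsProbabilityMeasure P] {V W : Ω → ℝ} (hV : AEMeasurable V P) (hW : AEMeasurable W P)
    (hlaw : P.map V = gaussianReal 0 1)
    (hind : IndepFun V W P) {κ : ℝ} (hκ : 2 * stdNormalPeak ≤ κ)
    (hint : Integrable (fun ω => Real.exp (κ * W ω)) P)
    (hexp : ∫ ω, Real.exp (κ * W ω) ∂P < 1) :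
    P.real {ω | 0 ≤ V ω + W ω} < 1 / 2 := by
  have hκ0 : 0 < κ := by linarith [stdNormalPeak_pos]
  have : IsProbabilityMeasure (P.map W) := Measure.isProbabilityMeasure_map hW
  have hprod := (indepFun_iff_map_prod_eq_prod_map_map hV hW).1 hind
  have hs : MeasurableSet {p : ℝ × ℝ | 0 ≤ p.1 + p.2} :=
    measurableSet_le measurable_const (measurable_fst.add measurable_snd)
  -- Conditioning on `W` and symmetry of the normal law give the probability as `E Φ(W)`.
  have e : P.real {ω | 0 ≤ V ω + W ω}
      = ∫ w, (gaussianReal 0 1).real (Set.Iic w) ∂(P.map W) := by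
    have h1 : P.real {ω | 0 ≤ V ω + W ω}
        = ((gaussianReal 0 1).prod (P.map W)).real {p : ℝ × ℝ | 0 ≤ p.1 + p.2} := by
      rw [← hlaw, ← hprod, map_measureReal_apply_of_aemeasurable (hV.prodMk hW) hs]
      rfl
    rw [h1, Measure.real, Measure.prod_apply_symm hs, ← integral_toReal]
    · refine integral_congr_ae (Filter.Eventually.of_forall fun w => ?_)
      have := gaussianReal_std_Ici_eq_Iic_neg (-w)
      rw [neg_neg] at this
      refine Eq.trans ?_ this
      simp only [Measure.real]
      congr 2
      ext x
      simp [neg_le_iff_add_nonneg]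
    · exact (measurable_measure_prodMk_right hs).aemeasurable
    · exact Filter.Eventually.of_forall fun w => measure_lt_top _ _
  rw [e]
  have hint' : Integrable (fun w => Real.exp (κ * w)) (P.map W) :=
    (integrable_map_measure (by fun_prop) hW).2 hint
  have hm : ∫ w, Real.exp (κ * w) ∂(P.map W) = ∫ ω, Real.exp (κ * W ω) ∂P :=
    integral_map hW (by fun_prop)
  have hΦ : Continuous fun w => (gaussianReal 0 1).real (Set.Iic w) :=
    continuous_iff_continuousAt.2 fun w => (hasDerivAt_gaussianReal_std_Iic w).continuousAt
  calc ∫ w, (gaussianReal 0 1).real (Set.Iic w) ∂(P.map W)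
      ≤ ∫ w, (1 / 2 + stdNormalPeak / κ * (Real.exp (κ * w) - 1)) ∂(P.map W) := by
        refine integral_mono (Integrable.of_bound hΦ.aestronglyMeasurable 1
          (Filter.Eventually.of_forall fun w => ?_))
          ((integrable_const _).add ((hint'.sub (integrable_const _)).const_mul _))
          fun w => gaussianReal_std_Iic_le_of_le hκ w
        rw [Real.norm_of_nonneg measureReal_nonneg]
        exact measureReal_le_one
    _ = 1 / 2 + stdNormalPeak / κ * (∫ ω, Real.exp (κ * W ω) ∂P - 1) := by
        have h1 : Integrable (fun w => Real.exp (κ * w) - 1) (P.map W) :=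
          hint'.sub (integrable_const _)
        rw [integral_add (integrable_const _) (h1.const_mul _),
          integral_const_mul, integral_sub hint' (integrable_const _), hm]
        simp
    _ < 1 / 2 := by
        have : stdNormalPeak / κ * (∫ ω, Real.exp (κ * W ω) ∂P - 1) < 0 :=
          mul_neg_of_pos_of_neg (div_pos stdNormalPeak_pos hκ0) (by linarith)
        linarith

/-! ### Maxima and comparison of their lower deviations. -/

section MaxCoord

variable {n : ℕ} [NeZero n]

lemma le_maxCoord (x : Fin n → ℝ) (i : Fin n) : x i ≤ maxCoord x :=
  Finset.le_sup' x (Finset.mem_univ i)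

lemma exists_eq_maxCoord (x : Fin n → ℝ) : ∃ i, maxCoord x = x i := by
  obtain ⟨i, -, hi⟩ := Finset.exists_mem_eq_sup' (Finset.univ_nonempty (α := Fin n)) x
  exact ⟨i, hi⟩

lemma maxCoord_lt_iff {x : Fin n → ℝ} {c : ℝ} : maxCoord x < c ↔ ∀ i, x i < c := by
  simp [maxCoord, Finset.sup'_lt_iff]

lemma le_maxCoord_iff {x : Fin n → ℝ} {c : ℝ} : c ≤ maxCoord x ↔ ∃ i, c ≤ x i := by
  simp [maxCoord, Finset.le_sup'_iff]

lemma measurable_maxCoord : Measurable (maxCoord : (Fin n → ℝ) → ℝ) := by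
  have := Finset.measurable_sup' (Finset.univ_nonempty (α := Fin n))
    (f := fun i (x : Fin n → ℝ) => x i) fun i _ => measurable_pi_apply i
  convert this using 1
  ext x
  simp [maxCoord, Finset.sup'_apply]

lemma abs_maxCoord_le (x : Fin n → ℝ) : |maxCoord x| ≤ ‖x‖ := by
  obtain ⟨i, hi⟩ := exists_eq_maxCoord x
  rw [hi]
  exact norm_le_pi_norm x i

lemma maxCoord_const_add_mul {a b : ℝ} (hb : 0 ≤ b) (x : Fin n → ℝ) :
    maxCoord (fun i => a + b * x i) = a + b * maxCoord x := by
  apply le_antisymm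
  · obtain ⟨i, hi⟩ := exists_eq_maxCoord fun i => a + b * x i
    rw [hi]
    have := mul_le_mul_of_nonneg_left (le_maxCoord x i) hb
    linarith
  · obtain ⟨i, hi⟩ := exists_eq_maxCoord x
    rw [hi]
    exact le_maxCoord (fun i => a + b * x i) i

lemma integrable_maxCoord (μ : Measure (Fin n → ℝ)) [IsGaussian μ] : Integrable maxCoord μ := by
  refine (IsGaussian.integrable_norm_pow μ 1).mono' measurable_maxCoord.aestronglyMeasurable
    (Filter.Eventually.of_forall fun x => ?_)
  simpa using abs_maxCoord_le x

lemma integrable_posPart_sub_maxCoord (μ : Measure (Fin n → ℝ)) [IsGaussian μ] (a : ℝ) :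
    Integrable (fun x => max (a - maxCoord x) 0) μ :=
  ((integrable_const a).sub (integrable_maxCoord μ)).pos_part

/-- Comparison of the lower tails of the maxima of two centered Gaussian vectors. -/
lemma integral_posPart_sub_maxCoord_le (μ ν : Measure (Fin n → ℝ))
    [IsGaussian μ] [IsGaussian ν] (hμ : ∀ i, ∫ w, w i ∂μ = 0) (hν : ∀ i, ∫ w, w i ∂ν = 0)
    (hd : ∀ i, ∫ w, w i * w i ∂μ = ∫ w, w i * w i ∂ν)
    (ho : ∀ i j, i ≠ j → ∫ w, w i * w j ∂μ ≤ ∫ w, w i * w j ∂ν) (a : ℝ) :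
    ∫ x, max (a - maxCoord x) 0 ∂μ ≤ ∫ x, max (a + 1 - maxCoord x) 0 ∂ν := by
  have hi1 := integrable_posPart_sub_maxCoord μ a
  have hi2 := integrable_posPart_sub_maxCoord ν (a + 1)
  have nn1 : 0 ≤ᵐ[μ] fun x => max (a - maxCoord x) 0 :=
    Filter.Eventually.of_forall fun _ => le_max_right _ _
  have nn2 : 0 ≤ᵐ[ν] fun x => max (a + 1 - maxCoord x) 0 :=
    Filter.Eventually.of_forall fun _ => le_max_right _ _
  rw [integral_eq_lintegral_of_nonneg_ae nn1 hi1.aestronglyMeasurable,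
    integral_eq_lintegral_of_nonneg_ae nn2 hi2.aestronglyMeasurable]
  refine ENNReal.toReal_mono hi2.lintegral_lt_top.ne ?_
  -- By the layer-cake formula it suffices to compare tails at each level `t > 0`; the unit shift in
  -- Slepian's inequality becomes the `+ 1` on the right.
  rw [lintegral_eq_lintegral_meas_lt μ nn1 hi1.aemeasurable,
    lintegral_eq_lintegral_meas_lt ν nn2 hi2.aemeasurable]
  refine setLIntegral_mono' measurableSet_Ioi fun t ht => ?_
  rw [Set.mem_Ioi] at ht
  refine (measure_mono ?_).trans ((slepian_shift μ ν hμ hν hd ho (a - t + 1)).trans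
    (measure_mono ?_))
  · intro x hx i
    rw [Set.mem_ofPred_eq, lt_max_iff, or_iff_left ht.not_gt] at hx
    have := le_maxCoord x i
    linarith
  · intro x hx
    rw [Set.mem_ofPred_eq, ← maxCoord_lt_iff] at hx
    rw [Set.mem_ofPred_eq, lt_max_iff]
    left
    linarith

end MaxCoord

/-! ### Independent standard normal coordinates. -/

section IidNormal

variable {α : Type*} [Fintype α]

/-- The law of independent standard normal variables. -/
noncomputable def iidNormal (α : Type*) [Fintype α] : Measure (α → ℝ) :=
  Measure.pi fun _ => gaussianReal 0 1

instance : IsProbabilityMeasure (iidNormal α) := by unfold iidNormal; infer_instance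

lemma iidNormal_map_eval (a : α) : (iidNormal α).map (fun z => z a) = gaussianReal 0 1 :=
  (measurePreserving_eval (fun _ : α => gaussianReal 0 1) a).map_eq

lemma iIndepFun_iidNormal : iIndepFun (fun (a : α) (z : α → ℝ) => z a) (iidNormal α) :=
  iIndepFun_pi (X := fun _ => id) fun _ => aemeasurable_id

instance : IsGaussian (iidNormal α) := by
  have h := iIndepFun_iidNormal (α := α)
  have := h.hasGaussianLaw fun a => ⟨by rw [iidNormal_map_eval]; infer_instance⟩
  have := this.isGaussian_map
  rwa [show (fun (z : α → ℝ) a => z a) = id from rfl, Measure.map_id] at this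

lemma iidNormal_integral_eval (a : α) {f : ℝ → ℝ} (hf : Measurable f) :
    ∫ z, f (z a) ∂(iidNormal α) = ∫ x, f x ∂(gaussianReal 0 1) := by
  rw [← iidNormal_map_eval a, integral_map (measurable_pi_apply a).aemeasurable
    hf.aestronglyMeasurable]

lemma iidNormal_integral_coord (a : α) : ∫ z, z a ∂(iidNormal α) = 0 := by
  rw [iidNormal_integral_eval a (f := fun x => x) measurable_id]
  exact integral_id_gaussianReal

lemma iidNormal_integral_coord_mul_self (a : α) : ∫ z, z a * z a ∂(iidNormal α) = 1 := by
  rw [iidNormal_integral_eval a (f := fun x => x * x) (by fun_prop)]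
  have := variance_fun_id_gaussianReal (μ := 0) (v := 1)
  rw [variance_eq_integral (by fun_prop)] at this
  simpa [pow_two] using this

lemma iidNormal_integral_coord_mul_coord {a b : α} (hab : a ≠ b) :
    ∫ z, z a * z b ∂(iidNormal α) = 0 := by
  rw [((iIndepFun_iidNormal (α := α)).indepFun hab).integral_fun_mul_eq_mul_integral
    (measurable_pi_apply a).aestronglyMeasurable (measurable_pi_apply b).aestronglyMeasurable,
    iidNormal_integral_coord, zero_mul]

end IidNormal

/-! ### The equicorrelated model and the lower deviation bound. -/

section Equicorrelated

variable {n : ℕ}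

/-- The linear map sending `(g, z₁, …, zₙ)` to the vector `(√ρ g + √(1 - ρ) zᵢ)ᵢ`. -/
noncomputable def equicorrelatedMap (n : ℕ) (ρ : ℝ) : (Option (Fin n) → ℝ) →L[ℝ] (Fin n → ℝ) :=
  ContinuousLinearMap.pi fun i => √ρ • ContinuousLinearMap.proj none
    + √(1 - ρ) • ContinuousLinearMap.proj (some i)

lemma equicorrelatedMap_apply (ρ : ℝ) (z : Option (Fin n) → ℝ) (i : Fin n) :
    equicorrelatedMap n ρ z i = √ρ * z none + √(1 - ρ) * z (some i) := by
  simp [equicorrelatedMap]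

lemma integral_equicorrelatedMap (ρ : ℝ) (i : Fin n) :
    ∫ w, w i ∂((iidNormal (Option (Fin n))).map (equicorrelatedMap n ρ)) = 0 := by
  rw [integral_map (f := fun w : Fin n → ℝ => w i) (by fun_prop)
    (measurable_pi_apply i).aestronglyMeasurable]
  simp only [equicorrelatedMap_apply]
  rw [integral_add ((IsGaussian.integrable_coord _ _).const_mul _)
    ((IsGaussian.integrable_coord _ _).const_mul _), integral_const_mul, integral_const_mul,
    iidNormal_integral_coord, iidNormal_integral_coord]
  simp

lemma integral_mul_equicorrelatedMap {ρ : ℝ} (h0 : 0 ≤ ρ) (h1 : ρ ≤ 1) (i j : Fin n) :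
    ∫ w, w i * w j ∂((iidNormal (Option (Fin n))).map (equicorrelatedMap n ρ))
      = if i = j then 1 else ρ := by
  rw [integral_map (by fun_prop) (by fun_prop)]
  simp only [equicorrelatedMap_apply]
  have e : ∀ z : Option (Fin n) → ℝ, (√ρ * z none + √(1 - ρ) * z (some i))
      * (√ρ * z none + √(1 - ρ) * z (some j))
      = ρ * (z none * z none) + √ρ * √(1 - ρ) * (z none * z (some j))
        + √ρ * √(1 - ρ) * (z none * z (some i)) + (1 - ρ) * (z (some i) * z (some j)) := fun z => by
    have a := Real.mul_self_sqrt h0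
    have b := Real.mul_self_sqrt (sub_nonneg.2 h1)
    linear_combination (z none * z none) * a + (z (some i) * z (some j)) * b
  have hI : ∀ (a b : Option (Fin n)) (c : ℝ),
      Integrable (fun z : Option (Fin n) → ℝ => c * (z a * z b)) (iidNormal _) := fun a b c =>
    (IsGaussian.integrable_coord_mul_coord _ a b).const_mul c
  simp only [e]
  rw [integral_add (Integrable.fun_add (Integrable.fun_add (hI _ _ _) (hI _ _ _)) (hI _ _ _))
    (hI _ _ _), integral_add (Integrable.fun_add (hI _ _ _) (hI _ _ _)) (hI _ _ _),
    integral_add (hI _ _ _) (hI _ _ _)]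
  simp only [integral_const_mul]
  rw [iidNormal_integral_coord_mul_self, iidNormal_integral_coord_mul_coord (by simp),
    iidNormal_integral_coord_mul_coord (by simp)]
  split_ifs with hij
  · rw [hij, iidNormal_integral_coord_mul_self]; ring
  · rw [iidNormal_integral_coord_mul_coord (by simpa using hij)]; ring

lemma iidNormal_real_forall_lt (r : ℝ) :
    (iidNormal (Option (Fin n))).real {z | ∀ i : Fin n, z (some i) < r}
      = (1 - (gaussianReal 0 1).real (Set.Ici r)) ^ n := by
  have : {z : Option (Fin n) → ℝ | ∀ i : Fin n, z (some i) < r}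
      = Set.pi Set.univ fun a : Option (Fin n) => a.elim Set.univ fun _ => Set.Iio r := by
    ext z
    simp [Option.forall]
  rw [this, iidNormal, Measure.real, Measure.pi_pi, ENNReal.toReal_prod, Fintype.prod_option]
  simp only [Option.elim, measure_univ, ENNReal.toReal_one, one_mul, Finset.prod_const,
    Finset.card_univ, Fintype.card_fin]
  rw [← probReal_compl_eq_one_sub measurableSet_Ici, Set.compl_Ici]
  rfl

/-- The expected number `nQ` of coordinates above `r` is at least a multiple of `r`, while `(1 -
Q)^n ≤ exp (-nQ)` and `u exp (-u) ≤ 1`. -/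
lemma mul_one_sub_pow_le_three {r t : ℝ} (hr : 0 ≤ r) (hrt : r ≤ t - 2)
    (hn : Real.exp (t ^ 2 / 2) = n) :
    r * (1 - (gaussianReal 0 1).real (Set.Ici r)) ^ n ≤ 3 := by
  set Q := (gaussianReal 0 1).real (Set.Ici r) with hQ
  have hQ1 : Q ≤ 1 := measureReal_le_one
  have hp := stdNormalPeak_pos
  have h3 : 1 ≤ 3 * stdNormalPeak := by
    rw [← one_le_sq_iff₀ (by positivity), mul_pow, stdNormalPeak_sq, mul_one_div, le_div_iff₀ (by positivity)]
    linarith [Real.pi_lt_d2]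
  -- The gap 2 gives `r + 1 ≤ t - 1`, and `exp (t²/2 - (t - 1)²/2) = exp (t - 1/2)` exceeds `r`.
  have hnQ : stdNormalPeak * r ≤ n * Q := by
    calc stdNormalPeak * r ≤ stdNormalPeak * Real.exp (t - 1 / 2) := by
          have := Real.add_one_le_exp (t - 1 / 2)
          gcongr
          linarith
      _ = n * (stdNormalPeak * Real.exp (-((t - 2 + 1) ^ 2 / 2))) := by
          rw [← hn, mul_left_comm, ← Real.exp_add]
          congr 2
          ring
      _ ≤ n * (stdNormalPeak * Real.exp (-((r + 1) ^ 2 / 2))) := by gcongr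
      _ ≤ n * Q := by gcongr; exact le_gaussianReal_std_Ici hr
  have hpow : (1 - Q) ^ n ≤ Real.exp (-(n * Q)) := by
    calc (1 - Q) ^ n ≤ Real.exp (-Q) ^ n := by
          refine pow_le_pow_left₀ (by linarith) ?_ n
          linarith [Real.add_one_le_exp (-Q)]
      _ = Real.exp (-(n * Q)) := by rw [← Real.exp_nat_mul]; ring_nf
  have hE : n * Q * Real.exp (-(n * Q)) ≤ 1 := by
    rw [Real.exp_neg, ← div_eq_mul_inv, div_le_one (Real.exp_pos _)]
    linarith [Real.add_one_le_exp (n * Q)]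
  have hpn : 0 ≤ (1 - Q) ^ n := pow_nonneg (by linarith) n
  calc r * (1 - Q) ^ n ≤ 3 * stdNormalPeak * r * (1 - Q) ^ n := by
        nlinarith [mul_nonneg hr hpn]
    _ ≤ 3 * (n * Q) * (1 - Q) ^ n := by nlinarith
    _ ≤ 3 * (n * Q) * Real.exp (-(n * Q)) := by
        have : 0 ≤ Q := measureReal_nonneg
        gcongr
    _ ≤ 3 := by linarith

/-- The lower deviation of the maximum of an equicorrelated standard normal vector is bounded. -/
lemma integral_posPart_sub_maxCoord_equicorrelated_le [NeZero n] {ρ t : ℝ} (h0 : 0 ≤ ρ) (h1 : ρ ≤ 1)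
    (hn : Real.exp (t ^ 2 / 2) = n) :
    ∫ w, max (√(1 - ρ) * (t - 2) + 1 - maxCoord w) 0
      ∂((iidNormal (Option (Fin n))).map (equicorrelatedMap n ρ)) ≤ 6 := by
  set r := t - 2 with hr
  set A : Set (Option (Fin n) → ℝ) := {z | ∀ i : Fin n, z (some i) < r} with hA
  have mA : MeasurableSet A := by
    rw [hA, Set.ofPred_forall]
    exact MeasurableSet.iInter fun i => measurableSet_lt (by fun_prop) measurable_const
  have hint : ∀ a : Option (Fin n),
      Integrable (fun z : Option (Fin n) → ℝ => |z a|) (iidNormal _) := fun a =>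
    (IsGaussian.integrable_coord _ a).abs
  have habs : ∀ a : Option (Fin n), ∫ z, |z a| ∂(iidNormal (Option (Fin n))) ≤ 1 := fun a => by
    rw [iidNormal_integral_eval a (f := fun x => |x|) (by fun_prop)]
    exact integral_abs_gaussianReal_std_le
  have hmeas : Measurable fun w : Fin n → ℝ => max (√(1 - ρ) * r + 1 - maxCoord w) 0 :=
    (measurable_const.sub measurable_maxCoord).max measurable_const
  rw [integral_map (by fun_prop) hmeas.aestronglyMeasurable]
  -- The dominating function: the shift, the common factor, and on `A` the bound `r - max zᵢ ≤ r -
  -- z₀`. The means are at most 1, 1, 1 and 3. The truncation `max r 0` covers small `n`, where `t <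
  -- 2`.
  have hI : Integrable (fun z : Option (Fin n) → ℝ => 1 + |z none| + |z (some 0)|
      + A.indicator (fun _ => max r 0) z) (iidNormal _) :=
    (((integrable_const 1).add (hint _)).add (hint _)).add ((integrable_const _).indicator mA)
  have hpt : ∀ z : Option (Fin n) → ℝ,
      max (√(1 - ρ) * r + 1 - maxCoord (equicorrelatedMap n ρ z)) 0
        ≤ 1 + |z none| + |z (some 0)| + A.indicator (fun _ => max r 0) z := by
    intro z
    have hind : 0 ≤ A.indicator (fun _ => max r 0) z :=
      Set.indicator_nonneg (fun _ _ => le_max_right _ _) z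
    refine max_le ?_ (by positivity)
    have e : equicorrelatedMap n ρ z = fun i => √ρ * z none + √(1 - ρ) * z (some i) :=
      funext (equicorrelatedMap_apply ρ z)
    rw [e, maxCoord_const_add_mul (Real.sqrt_nonneg _)]
    have hg : -(√ρ * z none) ≤ |z none| := by
      have a := neg_abs_le (√ρ * z none)
      rw [abs_mul, abs_of_nonneg (Real.sqrt_nonneg _)] at a
      have := mul_le_of_le_one_left (abs_nonneg (z none)) (Real.sqrt_le_one.2 h1)
      linarith
    set M := maxCoord fun i => z (some i) with hM
    have hθ : √(1 - ρ) * (r - M) ≤ |z (some 0)| + A.indicator (fun _ => max r 0) z := by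
      by_cases hz : z ∈ A
      · rw [Set.indicator_of_mem hz]
        have hMr : M < r := maxCoord_lt_iff.2 hz
        have : √(1 - ρ) * (r - M) ≤ r - M :=
          mul_le_of_le_one_left (by linarith) (Real.sqrt_le_one.2 (by linarith))
        have h2 : z (some 0) ≤ M := le_maxCoord (fun i => z (some i)) 0
        linarith [neg_abs_le (z (some 0)), le_max_left r 0]
      · have hMr : r ≤ M := by
          by_contra h
          exact hz (maxCoord_lt_iff.1 (not_le.1 h))
        have : √(1 - ρ) * (r - M) ≤ 0 :=
          mul_nonpos_of_nonneg_of_nonpos (Real.sqrt_nonneg _) (by linarith)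
        have := abs_nonneg (z (some 0))
        linarith
    linarith
  have hπ : (iidNormal (Option (Fin n))).real A * max r 0 ≤ 3 := by
    rw [hA, iidNormal_real_forall_lt]
    rcases le_total r 0 with h | h
    · rw [max_eq_right h, mul_zero]; norm_num
    · rw [max_eq_left h, mul_comm]
      exact mul_one_sub_pow_le_three h hr.le hn
  calc _ ≤ ∫ z, (1 + |z none| + |z (some 0)| + A.indicator (fun _ => max r 0) z)
        ∂(iidNormal (Option (Fin n))) := by
        refine integral_mono_of_nonneg (Filter.Eventually.of_forall fun _ => le_max_right _ _) hI
          (Filter.Eventually.of_forall hpt)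
    _ = 1 + ∫ z, |z none| ∂(iidNormal (Option (Fin n)))
        + ∫ z, |z (some 0)| ∂(iidNormal (Option (Fin n)))
        + (iidNormal (Option (Fin n))).real A * max r 0 := by
        rw [integral_add (Integrable.fun_add (Integrable.fun_add (integrable_const 1) (hint _))
          (hint _)) ((integrable_const _).indicator mA),
          integral_add (Integrable.fun_add (integrable_const 1) (hint _)) (hint _),
          integral_add (integrable_const 1) (hint _), integral_indicator mA]
        simp
    _ ≤ 6 := by linarith [habs none, habs (some 0)]

lemma exp_sqrt_two_mul_log_sq_div_two (n : ℕ) [NeZero n] :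
    Real.exp (√(2 * Real.log n) ^ 2 / 2) = n := by
  have hn1 : (1 : ℝ) ≤ n := by exact_mod_cast Nat.pos_of_ne_zero (NeZero.ne n)
  rw [Real.sq_sqrt (by have := Real.log_nonneg hn1; positivity), mul_div_cancel_left₀ _ two_ne_zero,
    Real.exp_log (by linarith)]

/-- The lower deviation of the maximum of a centered Gaussian vector with unit variances whose
correlations are at most `ρ` is bounded. -/
theorem integral_posPart_sub_maxCoord_le_six [NeZero n] (μ : Measure (Fin n → ℝ)) [IsGaussian μ]
    (hμ : ∀ i, ∫ w, w i ∂μ = 0) (hd : ∀ i, ∫ w, w i * w i ∂μ = 1) {ρ : ℝ} (h0 : 0 ≤ ρ)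
    (h1 : ρ ≤ 1) (ho : ∀ i j, i ≠ j → ∫ w, w i * w j ∂μ ≤ ρ) :
    ∫ w, max (√(1 - ρ) * (√(2 * Real.log n) - 2) - maxCoord w) 0 ∂μ ≤ 6 := by
  refine (integral_posPart_sub_maxCoord_le μ
    ((iidNormal (Option (Fin n))).map (equicorrelatedMap n ρ)) hμ (integral_equicorrelatedMap ρ)
    (fun i => ?_) (fun i j hij => ?_) _).trans
    (integral_posPart_sub_maxCoord_equicorrelated_le h0 h1
      (exp_sqrt_two_mul_log_sq_div_two n))
  · rw [hd, integral_mul_equicorrelatedMap h0 h1, if_pos rfl]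
  · rw [integral_mul_equicorrelatedMap h0 h1, if_neg hij]
    exact ho i j hij

end Equicorrelated

/-! ### Splitting an equicorrelated vector into its mean and residuals. -/

section Centering

variable {n : ℕ}

/-- The mean of the coordinates of a vector. -/
noncomputable def coordMean (n : ℕ) : (Fin n → ℝ) →L[ℝ] ℝ :=
  (n : ℝ)⁻¹ • ∑ j, ContinuousLinearMap.proj j

lemma coordMean_apply (x : Fin n → ℝ) : coordMean n x = (n : ℝ)⁻¹ * ∑ j, x j := by
  simp [coordMean]

/-- Subtraction of the mean of the coordinates. -/
noncomputable def subCoordMean (n : ℕ) : (Fin n → ℝ) →L[ℝ] (Fin n → ℝ) :=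
  ContinuousLinearMap.pi fun i => ContinuousLinearMap.proj i - coordMean n

lemma subCoordMean_apply (x : Fin n → ℝ) (i : Fin n) :
    subCoordMean n x i = x i - coordMean n x := by
  simp [subCoordMean]

lemma maxCoord_eq_coordMean_add [NeZero n] (x : Fin n → ℝ) :
    maxCoord x = coordMean n x + maxCoord (subCoordMean n x) := by
  rw [← one_mul (maxCoord (subCoordMean n x)), ← maxCoord_const_add_mul zero_le_one]
  congr 1
  ext i
  rw [subCoordMean_apply]
  ring

variable {μ : Measure (Fin n → ℝ)} [IsGaussian μ]

lemma integral_coordMean (hμ : ∀ i, ∫ w, w i ∂μ = 0) : ∫ w, coordMean n w ∂μ = 0 := by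
  simp only [coordMean_apply]
  rw [integral_const_mul, integral_finsetSum _ fun i _ => IsGaussian.integrable_coord μ i]
  simp [hμ]

lemma covariance_coord (hμ : ∀ i, ∫ w, w i ∂μ = 0) (i j : Fin n) :
    cov[fun w : Fin n → ℝ => w i, fun w => w j; μ] = ∫ w, w i * w j ∂μ := by
  have h : ∀ i, MemLp (fun w : Fin n → ℝ => w i) 2 μ := fun i =>
    IsGaussian.memLp_dual μ (ContinuousLinearMap.proj i) 2 (by simp)
  rw [covariance_eq_sub (h i) (h j), hμ i]
  simp

variable {ρ : ℝ}

lemma covariance_coord_coordMean (hμ : ∀ i, ∫ w, w i ∂μ = 0) (hd : ∀ i, ∫ w, w i * w i ∂μ = 1)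
    (ho : ∀ i j, i ≠ j → ∫ w, w i * w j ∂μ = ρ) (i : Fin n) :
    cov[fun w : Fin n → ℝ => w i, fun w => coordMean n w; μ] = (n : ℝ)⁻¹ * (1 + (n - 1) * ρ) := by
  have h : ∀ i, MemLp (fun w : Fin n → ℝ => w i) 2 μ := fun i =>
    IsGaussian.memLp_dual μ (ContinuousLinearMap.proj i) 2 (by simp)
  simp only [coordMean_apply]
  rw [covariance_const_mul_right, covariance_fun_sum_right h (h i)]
  simp only [covariance_coord hμ]
  congr 1
  have : ∀ j, ∫ w, w i * w j ∂μ = ρ + if j = i then 1 - ρ else 0 := fun j => by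
    split_ifs with hij
    · rw [hij, hd]; ring
    · rw [ho i j (Ne.symm hij)]; ring
  simp only [this, Finset.sum_add_distrib]
  simp
  ring

lemma variance_coordMean [NeZero n] (hμ : ∀ i, ∫ w, w i ∂μ = 0)
    (hd : ∀ i, ∫ w, w i * w i ∂μ = 1) (ho : ∀ i j, i ≠ j → ∫ w, w i * w j ∂μ = ρ) :
    Var[fun w => coordMean n w; μ] = (n : ℝ)⁻¹ * (1 + (n - 1) * ρ) := by
  have h : ∀ i, MemLp (fun w : Fin n → ℝ => w i) 2 μ := fun i =>
    IsGaussian.memLp_dual μ (ContinuousLinearMap.proj i) 2 (by simp)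
  have hA : MemLp (fun w => coordMean n w) 2 μ := IsGaussian.memLp_dual μ _ 2 (by simp)
  have hn : (n : ℝ) ≠ 0 := NeZero.ne _
  rw [← covariance_self hA.aemeasurable]
  have e : (fun w => coordMean n w) = fun w : Fin n → ℝ => (n : ℝ)⁻¹ * ∑ j, w j :=
    funext coordMean_apply
  nth_rewrite 1 [e]
  rw [covariance_const_mul_left, covariance_fun_sum_left h hA]
  simp only [covariance_coord_coordMean hμ hd ho, Finset.sum_const, Finset.card_univ,
    Fintype.card_fin, nsmul_eq_mul]
  field_simp

/-- Under equicorrelation every coordinate has the same covariance with the mean, which is therefore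
the variance of the mean. -/
lemma covariance_subCoordMean_coordMean [NeZero n] (hμ : ∀ i, ∫ w, w i ∂μ = 0)
    (hd : ∀ i, ∫ w, w i * w i ∂μ = 1) (ho : ∀ i j, i ≠ j → ∫ w, w i * w j ∂μ = ρ) (i : Fin n) :
    cov[fun w => subCoordMean n w i, fun w => coordMean n w; μ] = 0 := by
  have h : MemLp (fun w : Fin n → ℝ => w i) 2 μ :=
    IsGaussian.memLp_dual μ (ContinuousLinearMap.proj i) 2 (by simp)
  have hA : MemLp (fun w => coordMean n w) 2 μ := IsGaussian.memLp_dual μ _ 2 (by simp)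
  simp only [subCoordMean_apply]
  rw [covariance_fun_sub_left h hA hA, covariance_coord_coordMean hμ hd ho,
    covariance_self hA.aemeasurable, variance_coordMean hμ hd ho, sub_self]

lemma variance_subCoordMean [NeZero n] (hμ : ∀ i, ∫ w, w i ∂μ = 0)
    (hd : ∀ i, ∫ w, w i * w i ∂μ = 1) (ho : ∀ i j, i ≠ j → ∫ w, w i * w j ∂μ = ρ) (i : Fin n) :
    Var[fun w => subCoordMean n w i; μ] = 1 - (n : ℝ)⁻¹ * (1 + (n - 1) * ρ) := by
  have h : MemLp (fun w : Fin n → ℝ => w i) 2 μ :=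
    IsGaussian.memLp_dual μ (ContinuousLinearMap.proj i) 2 (by simp)
  have hA : MemLp (fun w => coordMean n w) 2 μ := IsGaussian.memLp_dual μ _ 2 (by simp)
  simp only [subCoordMean_apply]
  rw [variance_fun_sub h hA, covariance_coord_coordMean hμ hd ho, variance_coordMean hμ hd ho,
    ← covariance_self h.aemeasurable, covariance_coord hμ, hd]
  ring

lemma indepFun_coordMean_subCoordMean [NeZero n] (hμ : ∀ i, ∫ w, w i ∂μ = 0)
    (hd : ∀ i, ∫ w, w i * w i ∂μ = 1) (ho : ∀ i j, i ≠ j → ∫ w, w i * w j ∂μ = ρ) :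
    IndepFun (fun w => coordMean n w) (fun w => subCoordMean n w) μ := by
  have hG : HasGaussianLaw (fun w : Fin n → ℝ =>
      ((fun i => subCoordMean n w i), fun _ : Unit => coordMean n w)) μ :=
    (IsGaussian.hasGaussianLaw_id (μ := μ)).map_fun
      -- The mean is treated as a vector with one coordinate, since the independence criterion is
      -- stated for two families.
      ((subCoordMean n).prod (ContinuousLinearMap.pi fun _ : Unit => coordMean n))
  have := hG.indepFun_of_covariance_eval (X := fun i w => subCoordMean n w i)
    (Y := fun _ w => coordMean n w)
    fun i _ => covariance_subCoordMean_coordMean hμ hd ho i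
  exact (this.comp measurable_id (measurable_pi_apply ())).symm

lemma map_coordMean [NeZero n] (hμ : ∀ i, ∫ w, w i ∂μ = 0)
    (hd : ∀ i, ∫ w, w i * w i ∂μ = 1) (ho : ∀ i j, i ≠ j → ∫ w, w i * w j ∂μ = ρ) :
    μ.map (fun w => coordMean n w)
      = gaussianReal 0 ((n : ℝ)⁻¹ * (1 + (n - 1) * ρ)).toNNReal := by
  have := IsGaussian.map_eq_gaussianReal (μ := μ) (coordMean n)
  rw [integral_coordMean hμ, show Var[⇑(coordMean n); μ] = _ from variance_coordMean hμ hd ho] at this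
  exact this

lemma map_subCoordMean [NeZero n] (hμ : ∀ i, ∫ w, w i ∂μ = 0)
    (hd : ∀ i, ∫ w, w i * w i ∂μ = 1) (ho : ∀ i j, i ≠ j → ∫ w, w i * w j ∂μ = ρ) (i : Fin n) :
    μ.map (fun w => subCoordMean n w i)
      = gaussianReal 0 (1 - (n : ℝ)⁻¹ * (1 + (n - 1) * ρ)).toNNReal := by
  have := IsGaussian.map_eq_gaussianReal (μ := μ)
    ((ContinuousLinearMap.proj i).comp (subCoordMean n))
  have h0 : ∫ w, subCoordMean n w i ∂μ = 0 := by
    simp only [subCoordMean_apply]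
    rw [integral_sub (IsGaussian.integrable_coord μ i) (IsGaussian.integrable_dual μ _), hμ,
      integral_coordMean hμ, sub_zero]
  rw [show ∫ x, ((ContinuousLinearMap.proj i).comp (subCoordMean n)) x ∂μ = 0 from h0,
    show Var[⇑((ContinuousLinearMap.proj i).comp (subCoordMean n)); μ] = _ from
      variance_subCoordMean hμ hd ho i] at this
  exact this

lemma map_coord (hμ : ∀ i, ∫ w, w i ∂μ = 0) (hd : ∀ i, ∫ w, w i * w i ∂μ = 1) (i : Fin n) :
    μ.map (fun w => w i) = gaussianReal 0 1 := by
  have h : MemLp (fun w : Fin n → ℝ => w i) 2 μ :=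
    IsGaussian.memLp_dual μ (ContinuousLinearMap.proj i) 2 (by simp)
  have := IsGaussian.map_eq_gaussianReal (μ := μ) (ContinuousLinearMap.proj i)
  rw [show ∫ x, (ContinuousLinearMap.proj (R := ℝ) i : (Fin n → ℝ) →L[ℝ] ℝ) x ∂μ = 0 from hμ i,
    show Var[⇑(ContinuousLinearMap.proj (R := ℝ) i : (Fin n → ℝ) →L[ℝ] ℝ); μ] = 1 by
      rw [← hd i, ← covariance_coord hμ]
      exact (covariance_self h.aemeasurable).symm, Real.toNNReal_one] at this
  exact this

end Centering

/-! ### Upper bounds in the equicorrelated case. -/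

section Upper

/-- The union bound for small `ρ`: with `x = √(1 - ρ) t`, the factor `n exp (-x²/2) = exp (t² ρ /
2)` stays below `exp (1/π)`, and the denominator in the Mills bound finishes. -/
lemma mul_gaussianReal_std_Ici_lt_half {n : ℕ} {ρ t : ℝ} (ht : 2 ≤ t ^ 2) (ht0 : 0 < t) (h0 : 0 < ρ)
    (h1 : ρ < 1) (hn : Real.exp (t ^ 2 / 2) = n) (hρ : t ^ 2 * ρ < 2 / Real.pi * (1 - ρ)) :
    n * (gaussianReal 0 1).real (Set.Ici (√(1 - ρ) * t)) < 1 / 2 := by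
  have hπ := Real.pi_gt_d2
  have hπ0 := Real.pi_pos
  set x := √(1 - ρ) * t with hx
  have hx0 : 0 < x := mul_pos (Real.sqrt_pos.2 (by linarith)) ht0
  have hx2 : x ^ 2 = (1 - ρ) * t ^ 2 := by rw [hx, mul_pow, Real.sq_sqrt (by linarith)]
  have hp := stdNormalPeak_pos
  have hρ' : t ^ 2 * ρ * Real.pi < 2 * (1 - ρ) := by
    rw [div_mul_eq_mul_div, lt_div_iff₀ hπ0] at hρ
    exact hρ
  have hexp : n * Real.exp (-(x ^ 2 / 2)) ≤ Real.exp (1 / Real.pi) := by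
    rw [← hn, ← Real.exp_add, hx2, Real.exp_le_exp, le_div_iff₀ hπ0]
    nlinarith
  have hexp2 : Real.exp (1 / Real.pi) ^ 2 ≤ 2 := by
    rw [← Real.exp_nat_mul, ← Real.le_log_iff_exp_le two_pos]
    have : (2 : ℕ) * (1 / Real.pi) ≤ 0.64 := by
      push_cast
      rw [mul_one_div, div_le_iff₀ hπ0]
      linarith
    linarith [Real.log_two_gt_d9]
  -- From `t² ≥ 2` and `hρ'`, `ρ π < 1 - ρ`, so `1 - ρ ≥ π / (π + 1)`.
  have hxl : 2 * Real.pi ≤ x ^ 2 * (Real.pi + 1) := by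
    have h2 : ρ * (Real.pi + 1) ≤ 1 := by nlinarith
    have h3 : Real.pi ≤ (1 - ρ) * (Real.pi + 1) := by linarith
    have h4 : 0 ≤ (1 - ρ) * (Real.pi + 1) := by linarith
    rw [hx2]
    nlinarith
  have hlt : stdNormalPeak * Real.exp (1 / Real.pi) < x / 2 := by
    refine lt_of_pow_lt_pow_left₀ 2 (by positivity) ?_
    rw [mul_pow, stdNormalPeak_sq, div_pow]
    calc 1 / (2 * Real.pi) * Real.exp (1 / Real.pi) ^ 2 ≤ 1 / (2 * Real.pi) * 2 := by gcongr
      _ = 1 / Real.pi := by field_simp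
      _ < Real.pi / (2 * (Real.pi + 1)) := by
        rw [div_lt_div_iff₀ hπ0 (by positivity)]
        nlinarith
      _ = 2 * Real.pi / (Real.pi + 1) / 2 ^ 2 := by field_simp
      _ ≤ x ^ 2 / 2 ^ 2 := by
        gcongr
        rw [div_le_iff₀ (by positivity)]
        exact hxl
  calc n * (gaussianReal 0 1).real (Set.Ici x)
      ≤ n * (stdNormalPeak * Real.exp (-(x ^ 2 / 2)) / x) := by
        gcongr
        exact gaussianReal_std_Ici_le hx0
    _ = stdNormalPeak * (n * Real.exp (-(x ^ 2 / 2))) / x := by ring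
    _ ≤ stdNormalPeak * Real.exp (1 / Real.pi) / x := by gcongr
    _ < x / 2 / x := by gcongr
    _ = 1 / 2 := by field_simp

variable {n : ℕ} [NeZero n] {μ : Measure (Fin n → ℝ)} [IsGaussian μ] {ρ : ℝ}

lemma exp_maxCoord_le_sum {l : ℝ} (x : Fin n → ℝ) :
    Real.exp (l * maxCoord x) ≤ ∑ i, Real.exp (l * x i) := by
  obtain ⟨i, hi⟩ := exists_eq_maxCoord x
  rw [hi]
  exact Finset.single_le_sum (f := fun i => Real.exp (l * x i)) (fun j _ => (Real.exp_pos _).le)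
    (Finset.mem_univ i)

lemma integrable_exp_subCoordMean (hμ : ∀ i, ∫ w, w i ∂μ = 0)
    (hd : ∀ i, ∫ w, w i * w i ∂μ = 1) (ho : ∀ i j, i ≠ j → ∫ w, w i * w j ∂μ = ρ) (l : ℝ)
    (i : Fin n) : Integrable (fun w => Real.exp (l * subCoordMean n w i)) μ := by
  have := integrable_exp_mul_gaussianReal (μ := 0)
    (v := (1 - (n : ℝ)⁻¹ * (1 + (n - 1) * ρ)).toNNReal) l
  rw [← map_subCoordMean hμ hd ho i] at this
  exact (integrable_map_measure (f := fun w => subCoordMean n w i)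
    (g := fun x => Real.exp (l * x)) (by fun_prop)
    ((measurable_pi_apply i).comp (subCoordMean n).measurable).aemeasurable).1 this

lemma integrable_exp_maxCoord_subCoordMean (hμ : ∀ i, ∫ w, w i ∂μ = 0)
    (hd : ∀ i, ∫ w, w i * w i ∂μ = 1) (ho : ∀ i j, i ≠ j → ∫ w, w i * w j ∂μ = ρ) (l : ℝ) :
    Integrable (fun w => Real.exp (l * maxCoord (subCoordMean n w))) μ := by
  refine (integrable_finsetSum Finset.univ
    fun i _ => integrable_exp_subCoordMean hμ hd ho l i).mono' ?_
    (Filter.Eventually.of_forall fun w => ?_)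
  · exact (Real.measurable_exp.comp (measurable_const.mul
      (measurable_maxCoord.comp (subCoordMean n).measurable))).aestronglyMeasurable
  · rw [Real.norm_of_nonneg (Real.exp_pos _).le]
    exact exp_maxCoord_le_sum _

/-- The exponential moments of the maximum of the centered coordinates. -/
lemma integral_exp_maxCoord_subCoordMean_le (hμ : ∀ i, ∫ w, w i ∂μ = 0)
    (hd : ∀ i, ∫ w, w i * w i ∂μ = 1) (ho : ∀ i j, i ≠ j → ∫ w, w i * w j ∂μ = ρ) (h1 : ρ ≤ 1)
    (l : ℝ) : ∫ w, Real.exp (l * maxCoord (subCoordMean n w)) ∂μ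
      ≤ n * Real.exp ((1 - ρ) * l ^ 2 / 2) := by
  have hn : (1 : ℝ) ≤ n := by exact_mod_cast Nat.pos_of_ne_zero (NeZero.ne n)
  have hv : 1 - (n : ℝ)⁻¹ * (1 + (n - 1) * ρ) ≤ 1 - ρ := by
    have : (n : ℝ)⁻¹ * (1 + (n - 1) * ρ) = ρ + (1 - ρ) / n := by field_simp; ring
    rw [this]
    have : 0 ≤ (1 - ρ) / n := div_nonneg (by linarith) (by linarith)
    linarith
  calc _ ≤ ∫ w, ∑ i, Real.exp (l * subCoordMean n w i) ∂μ :=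
        integral_mono (integrable_exp_maxCoord_subCoordMean hμ hd ho l)
          (integrable_finsetSum Finset.univ
            fun i _ => integrable_exp_subCoordMean hμ hd ho l i) fun w => exp_maxCoord_le_sum _
    _ = ∑ _ : Fin n, Real.exp ((1 - (n : ℝ)⁻¹ * (1 + (n - 1) * ρ)).toNNReal * l ^ 2 / 2) := by
        rw [integral_finsetSum _ fun i _ => integrable_exp_subCoordMean hμ hd ho l i]
        refine Finset.sum_congr rfl fun i _ => ?_
        have := mgf_gaussianReal (map_subCoordMean hμ hd ho i) l
        simpa [mgf] using this
    _ ≤ n * Real.exp ((1 - ρ) * l ^ 2 / 2) := by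
        rw [Finset.sum_const, Finset.card_univ, Fintype.card_fin, nsmul_eq_mul]
        have : ((1 - (n : ℝ)⁻¹ * (1 + (n - 1) * ρ)).toNNReal : ℝ) ≤ 1 - ρ := by
          rw [Real.coe_toNNReal']
          exact max_le hv (by linarith)
        gcongr

lemma eq_zero_of_fin_one (h : n = 1) (i j : Fin n) : i = j := by
  subst h
  exact Subsingleton.elim i j

lemma sqrt_two_mul_log_pos (hn : n ≠ 1) : 0 < √(2 * Real.log n) := by
  have h0 := NeZero.ne n
  have h2 : 2 ≤ n := by omega
  have : (1 : ℝ) < n := by exact_mod_cast h2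
  have := Real.log_pos this
  positivity

lemma integral_maxCoord_le (hμ : ∀ i, ∫ w, w i ∂μ = 0)
    (hd : ∀ i, ∫ w, w i * w i ∂μ = 1) (ho : ∀ i j, i ≠ j → ∫ w, w i * w j ∂μ = ρ) (h1 : ρ < 1) :
    ∫ w, maxCoord w ∂μ ≤ √(1 - ρ) * √(2 * Real.log n) := by
  by_cases hn : n = 1
  · have e : ∀ w : Fin n → ℝ, maxCoord w = w 0 := fun w => by
      obtain ⟨i, hi⟩ := exists_eq_maxCoord w
      rw [hi, eq_zero_of_fin_one hn i 0]
    simp only [e, hμ]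
    positivity
  set t := √(2 * Real.log n) with ht
  have ht0 : 0 < t := sqrt_two_mul_log_pos hn
  set s := √(1 - ρ) with hs
  have hs0 : 0 < s := Real.sqrt_pos.2 (by linarith)
  have hs2 : s ^ 2 = 1 - ρ := Real.sq_sqrt (by linarith)
  -- The order `t / s` balances `log n = t²/2` against the variance term, also `t²/2`.
  have hM := integral_exp_maxCoord_subCoordMean_le hμ hd ho h1.le (t / s)
  have hexp : (n : ℝ) * Real.exp ((1 - ρ) * (t / s) ^ 2 / 2) = Real.exp (t ^ 2) := by
    nth_rewrite 1 [← exp_sqrt_two_mul_log_sq_div_two n]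
    rw [← ht, ← Real.exp_add, ← hs2]
    congr 1
    field_simp
    ring
  rw [hexp] at hM
  have hint : Integrable (fun w => maxCoord (subCoordMean n w)) μ := by
    have : (fun w => maxCoord (subCoordMean n w)) = fun w => maxCoord w - coordMean n w := by
      funext w
      rw [maxCoord_eq_coordMean_add w]
      ring
    rw [this]
    exact (integrable_maxCoord μ).sub (IsGaussian.integrable_dual μ _)
  have hW : ∫ w, maxCoord w ∂μ = ∫ w, maxCoord (subCoordMean n w) ∂μ := by
    have := integral_add (IsGaussian.integrable_dual μ (coordMean n)) hint
    rw [integral_coordMean hμ, zero_add] at this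
    rw [← this]
    exact integral_congr_ae (Filter.Eventually.of_forall maxCoord_eq_coordMean_add)
  have hE := integrable_exp_maxCoord_subCoordMean hμ hd ho (t / s)
  -- Jensen's inequality in tangent form: `u + 1 ≤ exp u`, centered at `t²`.
  have key : ∫ w, ((t / s) * maxCoord (subCoordMean n w) - t ^ 2 + 1) ∂μ
      ≤ ∫ w, Real.exp (-t ^ 2) * Real.exp ((t / s) * maxCoord (subCoordMean n w)) ∂μ := by
    refine integral_mono (((hint.const_mul _).sub (integrable_const _)).add (integrable_const _))
      (hE.const_mul _) fun w => ?_
    simp only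
    rw [← Real.exp_add]
    have := Real.add_one_le_exp (-t ^ 2 + (t / s) * maxCoord (subCoordMean n w))
    linarith
  have hsub : Integrable (fun w => t / s * maxCoord (subCoordMean n w) - t ^ 2) μ :=
    (hint.const_mul _).sub (integrable_const _)
  rw [integral_add hsub (integrable_const _),
    integral_sub (hint.const_mul _) (integrable_const _), integral_const_mul, integral_const_mul,
    ← hW] at key
  have hone : Real.exp (-t ^ 2) * ∫ w, Real.exp ((t / s) * maxCoord (subCoordMean n w)) ∂μ ≤ 1 := by
    calc _ ≤ Real.exp (-t ^ 2) * Real.exp (t ^ 2) := by gcongr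
      _ = 1 := by rw [← Real.exp_add]; simp
  simp only [integral_const, probReal_univ, one_smul] at key
  have : (t / s) * ∫ w, maxCoord w ∂μ ≤ t ^ 2 := by linarith
  rw [div_mul_eq_mul_div, div_le_iff₀ hs0, pow_two, mul_assoc] at this
  have := le_of_mul_le_mul_left this ht0
  linarith

/-- The union bound for the upper tail of the maximum. -/
lemma measureReal_le_maxCoord_le (hμ : ∀ i, ∫ w, w i ∂μ = 0) (hd : ∀ i, ∫ w, w i * w i ∂μ = 1)
    (m : ℝ) : μ.real {w | m ≤ maxCoord w} ≤ n * (gaussianReal 0 1).real (Set.Ici m) := by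
  have e : {w : Fin n → ℝ | m ≤ maxCoord w} = ⋃ i, {w | m ≤ w i} := by
    ext w
    simp [le_maxCoord_iff]
  rw [e]
  refine (measureReal_iUnion_fintype_le _).trans_eq ?_
  have : ∀ i : Fin n, μ.real {w | m ≤ w i} = (gaussianReal 0 1).real (Set.Ici m) := fun i => by
    rw [← map_coord hμ hd i, map_measureReal_apply (measurable_pi_apply i) measurableSet_Ici]
    rfl
  simp [this]

lemma measureReal_le_maxCoord_lt_half (hμ : ∀ i, ∫ w, w i ∂μ = 0)
    (hd : ∀ i, ∫ w, w i * w i ∂μ = 1) (ho : ∀ i j, i ≠ j → ∫ w, w i * w j ∂μ = ρ) (h0 : 0 < ρ)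
    (h1 : ρ < 1) {m : ℝ} (hm : √(1 - ρ) * √(2 * Real.log n) < m) :
    μ.real {w | m ≤ maxCoord w} < 1 / 2 := by
  by_cases hn : n = 1
  · have hm0 : 0 < m := lt_of_le_of_lt (by positivity) hm
    refine (measureReal_le_maxCoord_le hμ hd m).trans_lt ?_
    rw [gaussianReal_std_Ici_eq_Iic_neg, hn, Nat.cast_one, one_mul]
    refine (gaussianReal_std_Iic_le_exp _).trans_lt ?_
    have : Real.exp (2 * stdNormalPeak * -m) < 1 := by
      rw [Real.exp_lt_one_iff]
      have := mul_pos stdNormalPeak_pos hm0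
      linarith
    linarith
  have hπ := Real.pi_gt_d2
  have hπ0 := Real.pi_pos
  have hnexp := exp_sqrt_two_mul_log_sq_div_two n
  have ht0 : 0 < √(2 * Real.log n) := sqrt_two_mul_log_pos hn
  have hn2 : 2 ≤ n := by have := NeZero.ne n; omega
  have hn0 : (0 : ℝ) < n := by positivity
  have ht2 : √(2 * Real.log n) ^ 2 = 2 * Real.log n := by
    refine Real.sq_sqrt ?_
    have := Real.log_natCast_nonneg n
    positivity
  set t := √(2 * Real.log n) with ht
  set s := √(1 - ρ) with hs
  have hs0 : 0 < s := Real.sqrt_pos.2 (by linarith)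
  have hs2 : s ^ 2 = 1 - ρ := Real.sq_sqrt (by linarith)
  set q := (n : ℝ)⁻¹ * (1 + (n - 1) * ρ) with hq
  have hq' : q = ρ + (1 - ρ) / n := by rw [hq]; field_simp; ring
  have hq0 : 0 < q := by
    have : 0 < (1 - ρ) / n := div_pos (by linarith) hn0
    linarith
  -- With `q = Var A` and `κ = (t / s) √q`, this is the squared form of `κ ≥ 2p = √(2/π)`, the
  -- condition for using log-concavity of `Φ`.
  by_cases hcase : 2 / Real.pi * (1 - ρ) ≤ t ^ 2 * q
  · have hsq := Real.sqrt_pos.2 hq0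
    have hsq2 := Real.sq_sqrt hq0.le
    set τ := √q with hτ
    have hκ : 2 * stdNormalPeak ≤ t / s * τ := by
      refine le_of_sq_le_sq (a := 2 * stdNormalPeak) ?_ (by positivity)
      rw [mul_pow, stdNormalPeak_sq, mul_pow, div_pow, hs2, hsq2, div_mul_eq_mul_div,
        le_div_iff₀ (by linarith)]
      refine le_trans (le_of_eq ?_) hcase
      field_simp
    have e : {w : Fin n → ℝ | m ≤ maxCoord w}
        = {w | 0 ≤ τ⁻¹ * coordMean n w + τ⁻¹ * (maxCoord (subCoordMean n w) - m)} := by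
      ext w
      rw [Set.mem_ofPred_eq, Set.mem_ofPred_eq, maxCoord_eq_coordMean_add w, ← mul_add,
        mul_nonneg_iff_of_pos_left (inv_pos.2 hsq)]
      constructor <;> intro h <;> linarith
    rw [e]
    have hmeas : Measurable fun x : Fin n → ℝ => τ⁻¹ * (maxCoord x - m) :=
      (measurable_maxCoord.sub_const m).const_mul _
    have hexpeq : (fun w => Real.exp (t / s * τ * (τ⁻¹ * (maxCoord (subCoordMean n w) - m))))
        = fun w => Real.exp (-(t / s * m)) * Real.exp (t / s * maxCoord (subCoordMean n w)) := by
      funext w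
      rw [← Real.exp_add]
      congr 1
      field_simp
      ring
    refine measureReal_nonneg_add_lt_half (κ := t / s * τ)
      (V := fun w => τ⁻¹ * coordMean n w) (by fun_prop)
      (hmeas.comp (subCoordMean n).measurable).aemeasurable ?_ ?_ hκ ?_ ?_
    · have := map_coordMean hμ hd ho
      have h2 : μ.map (fun w => τ⁻¹ * coordMean n w)
          = (μ.map (fun w => coordMean n w)).map (τ⁻¹ * ·) := by
        rw [Measure.map_map (by fun_prop) (by fun_prop)]
        rfl
      rw [h2, this, gaussianReal_map_const_mul, mul_zero]
      congr 1
      ext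
      push_cast
      rw [Real.coe_toNNReal _ hq0.le, inv_pow, hsq2]
      exact inv_mul_cancel₀ hq0.ne'
    · exact (indepFun_coordMean_subCoordMean hμ hd ho).comp
        (φ := fun y => τ⁻¹ * y) (by fun_prop) hmeas
    · rw [hexpeq]
      exact (integrable_exp_maxCoord_subCoordMean hμ hd ho (t / s)).const_mul _
    · rw [hexpeq, integral_const_mul]
      have hM := integral_exp_maxCoord_subCoordMean_le hμ hd ho h1.le (t / s)
      calc _ ≤ Real.exp (-(t / s * m)) * (n * Real.exp ((1 - ρ) * (t / s) ^ 2 / 2)) := by gcongr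
        _ = Real.exp (t / s * (s * t - m)) := by
          nth_rewrite 1 [← hnexp]
          rw [← Real.exp_add, ← Real.exp_add, ← hs2]
          congr 1
          field_simp
          ring
        _ < 1 := by
          rw [Real.exp_lt_one_iff]
          exact mul_neg_of_pos_of_neg (by positivity) (by linarith)
  · rw [not_le] at hcase
    -- For `n = 2`, `t² q = (1 + ρ) log 2`, which exceeds `(2/π) (1 - ρ)` because `2/π ≤ 0.64 < log
    -- 2`.
    have hn3 : 3 ≤ n := by
      by_contra hlt
      have hn2' : n = 2 := by omega
      rw [hq', ht2, hn2'] at hcase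
      push_cast at hcase
      have h2 : 2 / Real.pi ≤ 0.64 := by
        rw [div_le_iff₀ hπ0]
        linarith
      have := Real.log_two_gt_d9
      nlinarith
    have ht2' : 2 ≤ t ^ 2 := by
      have h3 : (3 : ℝ) ≤ n := by exact_mod_cast hn3
      have : 1 ≤ Real.log n := by
        rw [Real.le_log_iff_exp_le hn0]
        linarith [Real.exp_one_lt_d9]
      linarith
    have hρ : t ^ 2 * ρ < 2 / Real.pi * (1 - ρ) := by
      refine lt_of_le_of_lt ?_ hcase
      rw [hq']
      have : 0 ≤ (1 - ρ) / n := div_nonneg (by linarith) hn0.le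
      gcongr
      linarith
    refine (measureReal_le_maxCoord_le hμ hd m).trans_lt (lt_of_le_of_lt ?_
      (mul_gaussianReal_std_Ici_lt_half ht2' ht0 h0 h1 hnexp hρ))
    exact mul_le_mul_of_nonneg_left (measureReal_mono (Set.Ici_subset_Ici.2 hm.le)) hn0.le

end Upper

/-! ### From deviations to means and medians. -/

section Final

/-- A lower bound for the medians of the maximum in terms of its lower deviation. -/
lemma le_of_half_le_measureReal_maxCoord_le {n : ℕ} [NeZero n] {μ : Measure (Fin n → ℝ)}
    [IsGaussian μ] {a c m : ℝ} (ha : ∫ w, max (a - maxCoord w) 0 ∂μ ≤ c)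
    (hm : 1 / 2 ≤ μ.real {w | maxCoord w ≤ m}) : a - 2 * c ≤ m := by
  have hc : 0 ≤ c := (integral_nonneg fun _ => le_max_right _ _).trans ha
  by_contra! h
  have hε : 0 < a - m := by linarith
  -- Markov's inequality: if `m < a`, then `(a - m) / 2 ≤ c`.
  have := mul_meas_ge_le_integral_of_nonneg (μ := μ) (f := fun w => max (a - maxCoord w) 0)
    (Filter.Eventually.of_forall fun _ => le_max_right _ _) (integrable_posPart_sub_maxCoord μ a)
    (a - m)
  have hsub : μ.real {w | maxCoord w ≤ m} ≤ μ.real {w | a - m ≤ max (a - maxCoord w) 0} := by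
    refine measureReal_mono fun w hw => ?_
    rw [Set.mem_ofPred_eq] at hw
    exact le_max_of_le_left (sub_le_sub_left hw a)
  nlinarith

lemma sub_le_integral_maxCoord {n : ℕ} [NeZero n] {μ : Measure (Fin n → ℝ)} [IsGaussian μ]
    {a c : ℝ} (ha : ∫ w, max (a - maxCoord w) 0 ∂μ ≤ c) : a - c ≤ ∫ w, maxCoord w ∂μ := by
  have : ∫ w, (a - maxCoord w) ∂μ ≤ ∫ w, max (a - maxCoord w) 0 ∂μ :=
    integral_mono ((integrable_const a).sub (integrable_maxCoord μ))
      (integrable_posPart_sub_maxCoord μ a) fun w => le_max_left _ _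
  rw [integral_sub (integrable_const a) (integrable_maxCoord μ)] at this
  simp only [integral_const, probReal_univ, one_smul] at this
  linarith

lemma log_log_three_pos : 0 < Real.log (Real.log 3) := by
  refine Real.log_pos ?_
  rw [Real.lt_log_iff_exp_lt (by norm_num)]
  linarith [Real.exp_one_lt_d9]

lemma log_log_three_le_ell2 (n : ℕ) : Real.log (Real.log 3) ≤ ell2 n := by
  have h3 : (0 : ℝ) < Real.log 3 := Real.log_pos (by norm_num)
  exact Real.log_le_log h3 (Real.log_le_log (by norm_num) (le_max_right _ _))

end Final

theorem proposition2p1 :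
    ∃ c₀ : ℝ, 0 < c₀ ∧
      ∀ (Ω : Type*) [MeasurableSpace Ω] (P : Measure Ω) [IsProbabilityMeasure P]
        (n : ℕ) [NeZero n] (X : Fin n → Ω → ℝ) (ρ₀ : ℝ),
        0 < ρ₀ → ρ₀ < 1 →
        HasGaussianLaw (fun ω i => X i ω) P →
        (∀ i, ∫ ω, X i ω ∂P = 0) →
        (∀ i, Var[X i; P] = 1) →
        (∀ i j, i ≠ j → corrMatrix X P i j ≤ ρ₀) →
        Integrable (fun ω => maxCoord (fun i => X i ω)) P ∧
        √(2 * (1 - ρ₀) * Real.log n) - c₀ * √(ell2 n) ≤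
          ∫ ω, maxCoord (fun i => X i ω) ∂P ∧
        (∀ m : ℝ, IsMedian (fun ω => maxCoord (fun i => X i ω)) P m →
          √(2 * (1 - ρ₀) * Real.log n) - c₀ * √(ell2 n) ≤ m) ∧
        ((∀ i j, i ≠ j → corrMatrix X P i j = ρ₀) →
          ∫ ω, maxCoord (fun i => X i ω) ∂P ≤ √(2 * (1 - ρ₀) * Real.log n) ∧
          ∀ m : ℝ, IsMedian (fun ω => maxCoord (fun i => X i ω)) P m →
            m ≤ √(2 * (1 - ρ₀) * Real.log n)) := by
  have hκ := Real.sqrt_pos.2 log_log_three_pos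
  -- At most 2 is lost from `√(1 - ρ) (t - 2)`, and 6 for the mean or `2 · 6` for a median. Dividing
  -- by the least value of `√(ell2 n)` makes the error term at least 14.
  refine ⟨14 / √(Real.log (Real.log 3)), by positivity, ?_⟩
  intro Ω _ P _ n _ X ρ h0 h1 hX hmean hvar hcorr
  have hXm : AEMeasurable (fun ω i => X i ω) P := hX.aemeasurable
  set μ : Measure (Fin n → ℝ) := P.map (fun ω i => X i ω) with hμdef
  have hG : IsGaussian μ := hX.isGaussian_map
  have hint : Integrable (fun ω => maxCoord (fun i => X i ω)) P :=
    (integrable_map_measure measurable_maxCoord.aestronglyMeasurable hXm).1 (integrable_maxCoord μ)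
  have hE : ∫ ω, maxCoord (fun i => X i ω) ∂P = ∫ w, maxCoord w ∂μ :=
    (integral_map hXm measurable_maxCoord.aestronglyMeasurable).symm
  have hμ : ∀ i, ∫ w, w i ∂μ = 0 := fun i => by
    rw [hμdef, integral_map (f := fun w : Fin n → ℝ => w i) hXm
      (measurable_pi_apply i).aestronglyMeasurable]
    exact hmean i
  have hcov : ∀ i j, cov[X i, X j; P] = ∫ w, w i * w j ∂μ := fun i j => by
    rw [← covariance_coord hμ, hμdef,
      covariance_map_fun (measurable_pi_apply i).aestronglyMeasurable
        (measurable_pi_apply j).aestronglyMeasurable hXm]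
  have hd : ∀ i, ∫ w, w i * w i ∂μ = 1 := fun i => by
    rw [← hcov, covariance_self (hXm.eval i), hvar]
  have hcorr' : ∀ i j, corrMatrix X P i j = ∫ w, w i * w j ∂μ := fun i j => by
    simp [corrMatrix, hvar, hcov]
  have hle : ∀ m : ℝ, P.real {ω | maxCoord (fun i => X i ω) ≤ m} = μ.real {w | maxCoord w ≤ m} :=
    fun m => (map_measureReal_apply_of_aemeasurable hXm
      (measurableSet_le measurable_maxCoord measurable_const)).symm
  have hge : ∀ m : ℝ, P.real {ω | m ≤ maxCoord (fun i => X i ω)} = μ.real {w | m ≤ maxCoord w} :=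
    fun m => (map_measureReal_apply_of_aemeasurable hXm
      (measurableSet_le measurable_const measurable_maxCoord)).symm
  have hsqrt : √(2 * (1 - ρ) * Real.log n) = √(1 - ρ) * √(2 * Real.log n) := by
    rw [← Real.sqrt_mul (by linarith)]
    congr 1
    ring
  have hell : 14 ≤ 14 / √(Real.log (Real.log 3)) * √(ell2 n) := by
    rw [div_mul_eq_mul_div, le_div_iff₀ hκ]
    have := Real.sqrt_le_sqrt (log_log_three_le_ell2 n)
    linarith
  have hdev := integral_posPart_sub_maxCoord_le_six μ hμ hd h0.le h1.le
    fun i j hij => (hcorr' i j).symm.trans_le (hcorr i j hij)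
  have hθ : √(1 - ρ) ≤ 1 := Real.sqrt_le_one.2 (by linarith)
  refine ⟨hint, ?_, fun m hm => ?_, fun heq => ⟨?_, fun m hm => ?_⟩⟩
  · rw [hE, hsqrt]
    have := sub_le_integral_maxCoord hdev
    linarith
  · have := le_of_half_le_measureReal_maxCoord_le hdev (hm.1.trans_eq (hle m))
    rw [hsqrt]
    linarith
  · rw [hE, hsqrt]
    exact integral_maxCoord_le hμ hd (fun i j hij => (hcorr' i j).symm.trans (heq i j hij)) h1
  · rw [hsqrt]
    by_contra! h
    have := measureReal_le_maxCoord_lt_half hμ hd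
      (fun i j hij => (hcorr' i j).symm.trans (heq i j hij)) h0 h1 h
    have h2 := hm.2.trans_eq (hge m)
    linarith
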